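/- A function $f:\mathbb R^{2\times 2}\to\mathbb R$ is rank-one convex if $t\mapsto f(A+tB)$ is convex for all $A,B\in\mathbb R^{2\times 2}$ with $B$ of rank one. The rank-one convex hull of a compact set $K\subset\mathbb R^{2\times2}$ is $K^{rc}=\{A\in\mathbb R^{2\times 2} : f(A)\le \max f(K)\text{ for all rank-one convex } f\}$ (empty if $K=\emptyset$). Matrices $A_1,\dots,A_4$ form a (possibly degenerate) $T_4$ configuration if $A_i=P+C_1+\dots+C_{i-1}+\kappa_iC_i$ $(i=1,\dots,4)$ for some matrix $P$, rank-one matrices $C_1,\dots,C_4$ with $\sum_i C_i=0$, and real numbers $\kappa_i\ge 1$. Identify $(x,y,z)\in\mathbb R^3$ with the upper triangular matrix $\begin{pmatrix}x&z\\0&y\end{pmatrix}$. Theorem. Let $K$ be a finite set of upper triangular real $2\times2$ matrices. Then $K^{rc}$ consists of upper triangular matrices and, as a subset of $\mathbb R^3$, is semialgebraic: there are finite sets $L,Q$ of real polynomials in $x,y,z$ such that $K^{rc}$ is a Boolean combination of sets of the form $\{p\ge 0\}$ and $\{p\le 0\}$ with $p\in L\cup Q$. Here every $p\in L$ has degree one,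 and every $q\in Q$ has the form $q=z+\alpha xy+\beta x+\gamma y+\delta$ with real $\alpha,\beta,\gamma,\delta$ and comes from a $T_4$ configuration over a cell of the planar grid, in the following sense. A cell is a rectangle $[a,b]\times[c,d]$, where $a<b$ are consecutive values of the $x$-coordinate on $K$ and $c<d$ are consecutive values of the $y$-coordinate on $K$. For every $q\in Q$ there is a cell such that the highest points of $K^{rc}$ (those with largest $z$) above its four vertices exist, form a $T_4$ configuration and are zeros of $q$ ($q$ is then called an upper quadric of the cell), or such that this holds for the lowest points ($q$ is a lower quadric of the cell). Moreover, for every cell $[a,b]\times[c,d]$, either no point of $K^{rc}$ lies above the open rectangle $(a,b)\times(c,d)$, or there are an upper quadric $q^u\in Q$ and a lower quadric $q^\ell\in Q$ of the cell such that $$K^{rc}\cap\big([a,b]\times[c,d]\times\mathbb R\big)=\{(x,y,z)\in[a,b]\times[c,d]\times\mathbb R : q^u(x,y,z)\le 0\le q^\ell(x,y,z)\}.$$ -/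

import Mathlib

namespace RankOneHull

/-- A real function on `n × m` matrices is rank-one convex if its restriction to every line whose
direction is a rank-one matrix is convex. -/
def IsRankOneConvex {n m : Type*} [Fintype n] [Fintype m] (f : Matrix n m ℝ → ℝ) : Prop :=
  ∀ A B : Matrix n m ℝ, B.rank = 1 → ConvexOn ℝ Set.univ (fun t : ℝ => f (A + t • B))

/-- The rank-one convex hull of `K`: all matrices `A` with `f A ≤ max f(K)` for every rank-one
convex `f`. The inequality is expressed through the upper bounds `c` of `f` on `K`, so that the
hull of the empty set is empty. -/
def rcHull {n m : Type*} [Fintype n] [Fintype m] (K : Set (Matrix n m ℝ)) : Set (Matrix n m ℝ) :=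
  {A | ∀ f : Matrix n m ℝ → ℝ, IsRankOneConvex f → ∀ c : ℝ, (∀ B ∈ K, f B ≤ c) → f A ≤ c}

/-- `T_N` configurations, degenerate ones (some `κ i = 1`) included. -/
def IsTConfig {n m : Type*} [Fintype n] [Fintype m] {N : ℕ} (K : Fin N → Matrix n m ℝ) : Prop :=
  ∃ (P : Matrix n m ℝ) (C : Fin N → Matrix n m ℝ) (κ : Fin N → ℝ),
    (∀ i, (C i).rank = 1) ∧ (∀ i, 1 ≤ κ i) ∧ ∑ i, C i = 0 ∧
      ∀ i, K i = P + ∑ j ∈ Finset.Iio i, C j + κ i • C i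

/-- The identification of the point `(x, y, z)` of `ℝ³` with an upper triangular matrix. -/
def triMatrix (v : Fin 3 → ℝ) : Matrix (Fin 2) (Fin 2) ℝ :=
  !![v 0, v 2;
     0,   v 1]

/-- The set `S` is semialgebraic and described by the polynomials in the finite set `P`:
it is a Boolean combination of sets `{p ≥ 0}` and `{p ≤ 0}` with `p ∈ P`. -/
def IsSemialgebraicBy {σ : Type*} (P : Finset (MvPolynomial σ ℝ)) (S : Set (σ → ℝ)) : Prop :=
  S ∈ BooleanSubalgebra.closure
    {T : Set (σ → ℝ) | ∃ p ∈ P, T = {v | 0 ≤ MvPolynomial.eval v p} ∨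
      T = {v | MvPolynomial.eval v p ≤ 0}}

/-- The polynomial `z + α x y + β x + γ y + δ` in the coordinates `(x, y, z)` of `ℝ³`. -/
noncomputable def quadric (α β γ δ : ℝ) : MvPolynomial (Fin 3) ℝ :=
  MvPolynomial.X 2 + MvPolynomial.C α * MvPolynomial.X 0 * MvPolynomial.X 1 +
    MvPolynomial.C β * MvPolynomial.X 0 + MvPolynomial.C γ * MvPolynomial.X 1 + MvPolynomial.C δ

/-- `a < b` are consecutive elements of `s`. -/
def IsConsecutive (s : Set ℝ) (a b : ℝ) : Prop :=
  a ∈ s ∧ b ∈ s ∧ a < b ∧ ∀ c ∈ s, c ≤ a ∨ b ≤ c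

/-- `[a, b] × [c, d]` is a (closed, bounded, two-dimensional) cell of the planar grid of `K`, the
arrangement of all horizontal and vertical lines through the points `(x, y)` that are the
diagonals of the matrices in `K`. -/
def IsGridCell (K : Set (Matrix (Fin 2) (Fin 2) ℝ)) (a b c d : ℝ) : Prop :=
  IsConsecutive ((fun A => A 0 0) '' K) a b ∧ IsConsecutive ((fun A => A 1 1) '' K) c d

/-- The points above the four vertices of `[a, b] × [c, d]`, in cyclic order, with heights `h`. -/
def cellPoint (a b c d : ℝ) (h : Fin 4 → ℝ) : Fin 4 → Fin 3 → ℝ :=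
  ![![a, c, h 0], ![b, c, h 1], ![b, d, h 2], ![a, d, h 3]]

/-- The polynomial `q` has the form `z + α x y + β x + γ y + δ` and its zero set passes through the
four points of a `T₄` configuration. -/
def IsT4Quadric (q : MvPolynomial (Fin 3) ℝ) (Q : Fin 4 → Fin 3 → ℝ) : Prop :=
  (∃ α β γ δ : ℝ, q = quadric α β γ δ) ∧ IsTConfig (fun i => triMatrix (Q i)) ∧
    ∀ i, MvPolynomial.eval (Q i) q = 0

/-- `q` is the quadric of the `T₄` configuration formed by the highest points of the rank-one
convex hull of `K` above the four vertices of the rectangle `[a, b] × [c, d]`. -/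
def IsUpperQuadric (K : Set (Matrix (Fin 2) (Fin 2) ℝ)) (a b c d : ℝ)
    (q : MvPolynomial (Fin 3) ℝ) : Prop :=
  ∃ h : Fin 4 → ℝ, IsT4Quadric q (cellPoint a b c d h) ∧
    ∀ i, IsGreatest {z : ℝ | triMatrix ![cellPoint a b c d h i 0, cellPoint a b c d h i 1, z] ∈
      rcHull K} (h i)

/-- `q` is the quadric of the `T₄` configuration formed by the lowest points of the rank-one
convex hull of `K` above the four vertices of the rectangle `[a, b] × [c, d]`. -/
def IsLowerQuadric (K : Set (Matrix (Fin 2) (Fin 2) ℝ)) (a b c d : ℝ)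
    (q : MvPolynomial (Fin 3) ℝ) : Prop :=
  ∃ h : Fin 4 → ℝ, IsT4Quadric q (cellPoint a b c d h) ∧
    ∀ i, IsLeast {z : ℝ | triMatrix ![cellPoint a b c d h i 0, cellPoint a b c d h i 1, z] ∈
      rcHull K} (h i)

end RankOneHull

/-!
Upper triangular matrices `(x, y, z)` differ by a matrix of rank at most one exactly when they have
the same `x` or the same `y`. A function `f(x, y, z)` is therefore rank-one convex on them if and
only if it is jointly convex in `(x, z)` and in `(y, z)`. For each slope `ξ` the infimum over `z` of
`f(x, y, z) - ξ z` is then a separately convex function `ψ(x, y)` (finite after a small multiple of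
`z²` is added to `f`), and `f` is the supremum of the functions `ξ z + ψ(x, y)` so obtained. So only
such functions are needed to describe the hull
(`exists_testFunction_of_pos`), and `ξ = ±1` suffices (`le_zero_of_mem_triHull'`).

Conversely, such a function has to be turned into a rank-one convex function on all of `ℝ^{2×2}`.
Only finitely many values of `ψ` matter, so `ψ` can be replaced by an interpolation on a finite grid
(`SepConvex.exists_extension`), whose mixed second differences are bounded. Along a rank-one
direction `B` the mixed term is at most a multiple of `|B₀₀ B₁₁| = |B₀₁ B₁₀|` and is absorbed by
`ε z²` plus a large multiple of the square of the lower left entry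
(`isRankOneConvex_of_mixed`); letting `ε → 0` gives `rcHull_eq_image_triHull`.

The shape of the hull over a cell follows from one more interpolation. Replacing `ψ` over the cell
by the bilinear interpolant of its values at the vertices keeps it separately convex, does not
change it on `K`, which lies over grid points, and does not decrease it over the cell
(`SepConvex.exists_bilinInterp`). Hence the upper and lower heights of the hull are bilinear on each
cell (`IsFace.mem_triHull_iff`), and a vertex without points of the hull above it leaves the whole
open cell without them (`IsFace.isVertexCovered`). The same statements hold, with affine
interpolants, over the edges and vertices of the grid, and the hull is the union of its finitely
many pieces. The points above the vertices of a cell form a closed polygon with rank-one sides,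
which is a `T₄` configuration with all `κ i = 1`.
-/

namespace RankOneHull

/-! ### Linear interpolation between two points -/

/-- The affine function that agrees with `φ` at `a` and `b`, evaluated at `x`. For `a = b` the
division by zero makes it the constant `φ a`; faces of the grid that are degenerate in one
direction are thereby covered by the same formulas as the cells. -/
noncomputable def interp (a b : ℝ) (φ : ℝ → ℝ) (x : ℝ) : ℝ :=
  φ a + (x - a) / (b - a) * (φ b - φ a)

theorem interp_left (a b : ℝ) (φ : ℝ → ℝ) : interp a b φ a = φ a := by simp [interp]

theorem interp_right {a b : ℝ} (φ : ℝ → ℝ) : interp a b φ b = φ b := by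
  rcases eq_or_ne a b with rfl | h
  · simp [interp]
  · rw [interp, div_self (sub_ne_zero.2 h.symm)]; ring

/-- On `[a, b]` interpolation is a convex combination of the two values, with weights that
do not depend on the function. -/
theorem interp_eq_combo {a b x : ℝ} (hx : x ∈ Set.Icc a b) :
    ∃ t ∈ Set.Icc (0 : ℝ) 1, x = (1 - t) * a + t * b ∧
      ∀ φ : ℝ → ℝ, interp a b φ x = (1 - t) * φ a + t * φ b := by
  have hab : a ≤ b := hx.1.trans hx.2
  refine ⟨(x - a) / (b - a), ⟨div_nonneg (by linarith [hx.1]) (by linarith),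
    div_le_one_of_le₀ (by linarith [hx.2]) (by linarith)⟩, ?_, fun φ => by rw [interp]; ring⟩
  rcases eq_or_lt_of_le hab with rfl | h
  · simp; linarith [hx.1, hx.2]
  · field_simp [(sub_pos.2 h).ne']; ring

theorem interp_mono {a b x : ℝ} (hx : x ∈ Set.Icc a b) {φ χ : ℝ → ℝ} (ha : φ a ≤ χ a)
    (hb : φ b ≤ χ b) : interp a b φ x ≤ interp a b χ x := by
  obtain ⟨t, ht, -, h⟩ := interp_eq_combo hx
  rw [h, h]
  exact add_le_add (mul_le_mul_of_nonneg_left ha (by linarith [ht.2]))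
    (mul_le_mul_of_nonneg_left hb ht.1)

theorem interp_add_const (a b : ℝ) (φ : ℝ → ℝ) (c x : ℝ) :
    interp a b (fun r => φ r + c) x = interp a b φ x + c := by
  simp only [interp]; ring

theorem convexOn_univ_of_le {φ : ℝ → ℝ} (h : ∀ x y s t : ℝ, 0 ≤ s → 0 ≤ t → s + t = 1 →
    φ (s * x + t * y) ≤ s * φ x + t * φ y) : ConvexOn ℝ Set.univ φ :=
  ⟨convex_univ, fun x _ y _ s t hs ht hst => by simpa using h x y s t hs ht hst⟩

theorem convexOn_univ_le {φ : ℝ → ℝ} (hφ : ConvexOn ℝ Set.univ φ) {x y s t : ℝ} (hs : 0 ≤ s)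
    (ht : 0 ≤ t) (hst : s + t = 1) : φ (s * x + t * y) ≤ s * φ x + t * φ y := by
  simpa using hφ.2 (Set.mem_univ x) (Set.mem_univ y) hs ht hst

theorem convexOn_affine (m k : ℝ) : ConvexOn ℝ Set.univ (fun x : ℝ => m * x + k) :=
  convexOn_univ_of_le fun x y s t _ _ hst => le_of_eq (by linear_combination (-k) * hst)

theorem convexOn_interp (a b : ℝ) (φ : ℝ → ℝ) : ConvexOn ℝ Set.univ (interp a b φ) := by
  convert convexOn_affine ((φ b - φ a) / (b - a)) (φ a - (φ b - φ a) / (b - a) * a) using 2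
  simp only [interp]; ring

theorem le_interp {φ : ℝ → ℝ} (hφ : ConvexOn ℝ Set.univ φ) {a b x : ℝ} (hx : x ∈ Set.Icc a b) :
    φ x ≤ interp a b φ x := by
  obtain ⟨t, ht, hxt, h⟩ := interp_eq_combo hx
  rw [h]
  nth_rewrite 1 [hxt]
  exact convexOn_univ_le hφ (by linarith [ht.2]) ht.1 (by ring)

/-- The chord of a convex function lies below the function outside of the interval. -/
theorem interp_le {φ : ℝ → ℝ} (hφ : ConvexOn ℝ Set.univ φ) {a b x : ℝ} (hab : a < b)
    (hx : x ≤ a ∨ b ≤ x) : interp a b φ x ≤ φ x := by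
  have hba : 0 < b - a := sub_pos.2 hab
  rw [interp, div_mul_eq_mul_div, ← le_sub_iff_add_le', div_le_iff₀ hba]
  rcases hx with hx | hx
  · obtain ⟨t, ht, hat, h⟩ := interp_eq_combo (a := x) (b := b) (x := a) ⟨hx, hab.le⟩
    have h1 := le_interp hφ (a := x) (b := b) (x := a) ⟨hx, hab.le⟩
    rw [h] at h1
    have h2 : a - x = t * (b - x) := by linear_combination hat
    have h3 : b - a = (1 - t) * (b - x) := by linear_combination -hat
    have h4 : x - a = -(t * (b - x)) := by linear_combination -hat
    rw [h3, h4]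
    have h5 : 0 ≤ b - x := by linarith
    nlinarith [mul_le_mul_of_nonneg_right h1 h5]
  · obtain ⟨t, ht, hbt, h⟩ := interp_eq_combo (a := a) (b := x) (x := b) ⟨hab.le, hx⟩
    have h1 := le_interp hφ (a := a) (b := x) (x := b) ⟨hab.le, hx⟩
    rw [h] at h1
    have h3 : b - a = t * (x - a) := by linear_combination hbt
    rw [h3]
    have h5 : 0 ≤ x - a := by linarith
    nlinarith [mul_le_mul_of_nonneg_right h1 h5]

theorem interp_lipschitz {φ : ℝ → ℝ} {a b L : ℝ} (hab : a < b)
    (h : |φ b - φ a| ≤ L * |b - a|) (x y : ℝ) :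
    |interp a b φ x - interp a b φ y| ≤ L * |x - y| := by
  have h1 : interp a b φ x - interp a b φ y = (φ b - φ a) / (b - a) * (x - y) := by
    simp only [interp]; ring
  rw [h1, abs_mul, abs_div]
  gcongr
  rwa [div_le_iff₀ (abs_pos.2 (sub_pos.2 hab).ne')]

/-! ### Consecutive values of a finite set -/

/-- `a ≤ b` are elements of `s` and no element of `s` lies strictly between them. -/
def IsGap (s : Set ℝ) (a b : ℝ) : Prop :=
  a ∈ s ∧ b ∈ s ∧ a ≤ b ∧ ∀ c ∈ s, c ≤ a ∨ b ≤ c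

theorem exists_isGap_of_lt {s : Set ℝ} (hs : s.Finite) {l u x : ℝ} (hl : l ∈ s) (hu : u ∈ s)
    (hlx : l ≤ x) (hxu : x < u) : ∃ a b, IsGap s a b ∧ a ≤ x ∧ x < b := by
  obtain ⟨a, ⟨has, hax⟩, ha⟩ := Set.exists_max_image (s ∩ Set.Iic x) id
    (hs.subset Set.inter_subset_left) ⟨l, hl, hlx⟩
  obtain ⟨b, ⟨hbs, hxb⟩, hb⟩ := Set.exists_min_image (s ∩ Set.Ioi x) id
    (hs.subset Set.inter_subset_left) ⟨u, hu, hxu⟩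
  refine ⟨a, b, ⟨has, hbs, (lt_of_le_of_lt hax hxb).le, fun c hc => ?_⟩, hax, hxb⟩
  rcases le_or_gt c x with h | h
  · exact .inl (ha c ⟨hc, h⟩)
  · exact .inr (hb c ⟨hc, h⟩)

/-- Every number between two elements of `s` is an element of `s` or lies in an open interval
between two consecutive elements. -/
theorem exists_isGap {s : Set ℝ} (hs : s.Finite) {l u x : ℝ} (hl : l ∈ s) (hu : u ∈ s)
    (hlx : l ≤ x) (hxu : x ≤ u) :
    ∃ a b, IsGap s a b ∧ x ∈ Set.Icc a b ∧ (a = b ∨ x ∈ Set.Ioo a b) := by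
  by_cases hx : x ∈ s
  · exact ⟨x, x, ⟨hx, hx, le_rfl, fun c _ => le_total c x⟩, ⟨le_rfl, le_rfl⟩, .inl rfl⟩
  · obtain ⟨a, b, hab, hax, hxb⟩ := exists_isGap_of_lt hs hl hu hlx
      (lt_of_le_of_ne hxu fun h => hx (h ▸ hu))
    have hax' := lt_of_le_of_ne hax fun h => hx (h ▸ hab.1)
    exact ⟨a, b, hab, ⟨hax, hxb.le⟩, .inr ⟨hax', hxb⟩⟩

theorem exists_isGap_Icc {s : Set ℝ} (hs : s.Finite) {l u x : ℝ} (hl : l ∈ s) (hu : u ∈ s)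
    (hlu : l < u) (hmax : ∀ c ∈ s, c ≤ u) (hx : x ∈ Set.Icc l u) :
    ∃ a b, IsGap s a b ∧ a < b ∧ x ∈ Set.Icc a b := by
  rcases hx.2.lt_or_eq with h | rfl
  · obtain ⟨a, b, hab, hax, hxb⟩ := exists_isGap_of_lt hs hl hu hx.1 h
    exact ⟨a, b, hab, hax.trans_lt hxb, hax, hxb.le⟩
  · obtain ⟨a, ⟨has, hax⟩, ha⟩ := Set.exists_max_image (s ∩ Set.Iio x) id
      (hs.subset Set.inter_subset_left) ⟨l, hl, hlu⟩
    refine ⟨a, x, ⟨has, hu, le_of_lt hax, fun c hc => ?_⟩, hax, le_of_lt hax, le_rfl⟩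
    rcases lt_or_ge c x with h | h
    · exact .inl (ha c ⟨hc, h⟩)
    · exact .inr h

/-! ### Piecewise linear interpolation on a finite set of nodes -/

theorem abs_clamp_sub_le (l u x y : ℝ) : |max l (min u x) - max l (min u y)| ≤ |x - y| := by
  have h1 := abs_max_sub_max_le_max l (min u x) l (min u y)
  have h2 := abs_min_sub_min_le_max u x u y
  rw [sub_self, abs_zero, max_eq_right (abs_nonneg (min u x - min u y))] at h1
  rw [sub_self, abs_zero, max_eq_right (abs_nonneg (x - y))] at h2
  exact h1.trans h2

/-- Piecewise linear interpolation `I` with the nodes `X`, constant outside of the range of `X`.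
It is linear and positive, and for a convex function with Lipschitz constant `L` on the nodes it
becomes convex on the whole line after `L` times the distance `d` to the range of `X` is added. -/
theorem exists_piecewise_interpolation {X : Set ℝ} (hX : X.Finite) (hX2 : X.Nontrivial) :
    ∃ (I : (ℝ → ℝ) → ℝ → ℝ) (d : ℝ → ℝ),
      (∀ x, ∃ p ∈ X, ∃ q ∈ X, ∃ t ∈ Set.Icc (0 : ℝ) 1, ∀ φ, I φ x = (1 - t) * φ p + t * φ q) ∧
      (∀ φ, ∀ x ∈ X, I φ x = φ x) ∧
      (∀ x ∈ X, d x = 0) ∧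
      (∀ φ L, 0 ≤ L → (∀ p ∈ X, ∀ q ∈ X, |φ p - φ q| ≤ L * |p - q|) →
        ∀ x y, |I φ x - I φ y| ≤ L * |x - y|) ∧
      (∀ φ L, 0 ≤ L → ConvexOn ℝ Set.univ φ → (∀ p ∈ X, ∀ q ∈ X, |φ p - φ q| ≤ L * |p - q|) →
        ConvexOn ℝ Set.univ (fun x => I φ x + L * d x)) := by
  obtain ⟨l, hl, hmin⟩ := Set.exists_min_image X id hX hX2.nonempty
  obtain ⟨u, hu, hmax⟩ := Set.exists_max_image X id hX hX2.nonempty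
  simp only [id] at hmin hmax
  have hlu : l < u := by
    obtain ⟨p, hp, q, hq, hpq⟩ := hX2
    rcases hpq.lt_or_gt with h | h
    · exact (hmin p hp).trans_lt (h.trans_le (hmax q hq))
    · exact (hmin q hq).trans_lt (h.trans_le (hmax p hp))
  set cl : ℝ → ℝ := fun x => max l (min u x) with hcl
  have hclI : ∀ x, cl x ∈ Set.Icc l u := fun x =>
    ⟨le_max_left _ _, max_le hlu.le (min_le_left _ _)⟩
  have hclid : ∀ x ∈ Set.Icc l u, cl x = x := fun x hx => by simp [hcl, hx.1, hx.2]
  have hXI : ∀ x ∈ X, x ∈ Set.Icc l u := fun x hx => ⟨hmin x hx, hmax x hx⟩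
  choose p q hgap hpq hmem using fun x =>
    exists_isGap_Icc hX hl hu hlu hmax (hclI x)
  set I : (ℝ → ℝ) → ℝ → ℝ := fun φ x => interp (p x) (q x) φ (cl x) with hI
  have hInode : ∀ φ, ∀ x ∈ X, I φ x = φ x := by
    intro φ x hx
    have h := hmem x
    simp only [hI]
    rw [hclid x (hXI x hx)] at h ⊢
    rcases (hgap x).2.2.2 x hx with h' | h'
    · have e : p x = x := le_antisymm h.1 h'
      rw [e, interp_left]
    · have e : q x = x := le_antisymm h' h.2
      rw [e, interp_right]
  have hIlip : ∀ φ L, 0 ≤ L → (∀ p ∈ X, ∀ q ∈ X, |φ p - φ q| ≤ L * |p - q|) →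
      ∀ x y, cl x ≤ cl y → |I φ x - I φ y| ≤ L * |cl x - cl y| := by
    intro φ L hL hφ x y hxy
    have hlip : ∀ z s t, |interp (p z) (q z) φ s - interp (p z) (q z) φ t| ≤ L * |s - t| :=
      fun z => interp_lipschitz (hpq z) (hφ _ (hgap z).2.1 _ (hgap z).1)
    by_cases hle : q x ≤ p y
    · have h1 := hlip x (cl x) (q x)
      have h2 := hφ _ (hgap x).2.1 _ (hgap y).1
      have h3 := hlip y (p y) (cl y)
      rw [interp_right] at h1
      rw [interp_left] at h3
      rw [abs_sub_comm (cl x), abs_of_nonneg (sub_nonneg.2 (hmem x).2)] at h1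
      rw [abs_sub_comm (q x), abs_of_nonneg (sub_nonneg.2 hle)] at h2
      rw [abs_sub_comm (p y), abs_of_nonneg (sub_nonneg.2 (hmem y).1)] at h3
      rw [abs_sub_comm (cl x), abs_of_nonneg (sub_nonneg.2 hxy)]
      calc |I φ x - I φ y| = |(I φ x - φ (q x)) + (φ (q x) - φ (p y)) + (φ (p y) - I φ y)| := by
            congr 1; ring
        _ ≤ |I φ x - φ (q x)| + |φ (q x) - φ (p y)| + |φ (p y) - I φ y| := abs_add_three _ _ _
        _ ≤ L * (cl y - cl x) := by simp only [hI]; linarith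
    · have h1 : p y ≤ p x := ((hgap x).2.2.2 _ (hgap y).1).resolve_right hle
      by_cases hle' : q y ≤ p x
      · have e : cl x = cl y := le_antisymm hxy (((hmem y).2.trans hle').trans (hmem x).1)
        have e1 : cl x = p x := le_antisymm (by linarith [(hmem y).2]) (hmem x).1
        have e2 : cl y = q y := le_antisymm (hmem y).2 (by linarith [(hmem x).1])
        have e3 : I φ x = I φ y := by
          simp only [hI]
          conv_lhs => rw [e1, interp_left]
          conv_rhs => rw [e2, interp_right]
          rw [← e1, ← e2, e]
        simp [e, e3]
      · have h2 : p x ≤ p y := ((hgap y).2.2.2 _ (hgap x).1).resolve_right hle'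
        have e : p x = p y := le_antisymm h2 h1
        have e' : q x = q y := by
          have h3 := ((hgap x).2.2.2 _ (hgap y).2.1).resolve_left (by linarith [hpq y])
          have h4 := ((hgap y).2.2.2 _ (hgap x).2.1).resolve_left (by linarith [hpq x])
          exact le_antisymm h3 h4
        have h5 := hlip y (cl x) (cl y)
        simp only [hI]
        rw [e, e']
        exact h5
  refine ⟨I, fun x => |x - cl x|, fun x => ?_, hInode, fun x hx => ?_, ?_, ?_⟩
  · obtain ⟨t, ht, -, h⟩ := interp_eq_combo (hmem x)
    exact ⟨p x, (hgap x).1, q x, (hgap x).2.1, t, ht, h⟩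
  · simp [hclid x (hXI x hx)]
  · intro φ L hL hφ x y
    refine le_trans ?_ (mul_le_mul_of_nonneg_left (abs_clamp_sub_le l u x y) hL)
    rcases le_total (cl x) (cl y) with h | h
    · exact hIlip φ L hL hφ x y h
    · have := hIlip φ L hL hφ y x h
      rwa [abs_sub_comm, abs_sub_comm (cl x)]
  · intro φ L hL hconv hφ
    set g : ℝ → ℝ := fun x => I φ x + L * |x - cl x| with hg
    -- Affine functions of slope at most `L` below `φ` on the nodes stay below the interpolation.
    have below : ∀ m k, |m| ≤ L → (∀ r ∈ X, m * r + k ≤ φ r) → ∀ x, m * x + k ≤ g x := by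
      intro m k hm hX x
      obtain ⟨t, ht, hx, h⟩ := interp_eq_combo (hmem x)
      have h1 := hX _ (hgap x).1
      have h2 := hX _ (hgap x).2.1
      have h3 : m * (x - cl x) ≤ L * |x - cl x| :=
        (le_abs_self _).trans (by rw [abs_mul]; gcongr)
      have h4 : m * cl x + k ≤ I φ x := by
        simp only [hI]
        rw [h φ]
        nth_rewrite 1 [hx]
        nlinarith [mul_le_mul_of_nonneg_left h1 (sub_nonneg.2 ht.2),
          mul_le_mul_of_nonneg_left h2 ht.1]
      simp only [hg]
      linarith
    -- Each point of the graph lies on such an affine function.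
    have touch : ∀ x, ∃ m k, |m| ≤ L ∧ (∀ r ∈ X, m * r + k ≤ φ r) ∧ m * x + k = g x := by
      intro x
      rcases lt_or_ge x l with hx | hx
      · have hc : cl x = l := by simp [hcl, (hx.trans hlu).le, hx.le]
        refine ⟨-L, φ l + L * l, by rw [abs_neg, abs_of_nonneg hL], fun r hr => ?_, ?_⟩
        · have := (abs_le.1 (hφ r hr l hl)).1
          rw [abs_of_nonneg (sub_nonneg.2 (hmin r hr))] at this
          linarith
        · have h1 : I φ x = φ l := by
            rw [← hInode φ l hl]
            have := hIlip φ L hL hφ x l (by rw [hc, hclid l (hXI l hl)])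
            rw [hc, hclid l (hXI l hl), sub_self, abs_zero, mul_zero] at this
            exact sub_eq_zero.1 (abs_nonpos_iff.1 this)
          simp only [hg]
          rw [h1, hc, abs_of_neg (sub_neg.2 hx)]; ring
      · rcases lt_or_ge u x with hx' | hx'
        · have hc : cl x = u := by simp [hcl, hlu.le, hx'.le]
          refine ⟨L, φ u - L * u, by rw [abs_of_nonneg hL], fun r hr => ?_, ?_⟩
          · have := (abs_le.1 (hφ r hr u hu)).1
            rw [abs_sub_comm, abs_of_nonneg (sub_nonneg.2 (hmax r hr))] at this
            linarith
          · have h1 : I φ x = φ u := by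
              rw [← hInode φ u hu]
              have := hIlip φ L hL hφ x u (by rw [hc, hclid u (hXI u hu)])
              rw [hc, hclid u (hXI u hu), sub_self, abs_zero, mul_zero] at this
              exact sub_eq_zero.1 (abs_nonpos_iff.1 this)
            simp only [hg]
            rw [h1, hc, abs_of_pos (sub_pos.2 hx')]; ring
        · have hc : cl x = x := hclid x ⟨hx, hx'⟩
          have hform : ∀ r, (φ (q x) - φ (p x)) / (q x - p x) * r +
              (φ (p x) - (φ (q x) - φ (p x)) / (q x - p x) * p x) = interp (p x) (q x) φ r := by
            intro r; simp only [interp]; ring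
          refine ⟨(φ (q x) - φ (p x)) / (q x - p x),
            φ (p x) - (φ (q x) - φ (p x)) / (q x - p x) * p x, ?_, fun r hr => ?_, ?_⟩
          · rw [abs_div, div_le_iff₀ (abs_pos.2 (sub_pos.2 (hpq x)).ne')]
            exact hφ _ (hgap x).2.1 _ (hgap x).1
          · rw [hform]
            exact interp_le hconv (hpq x) ((hgap x).2.2.2 r hr)
          · rw [hform]
            simp only [hg, hI]
            rw [hc]; simp
    refine convexOn_univ_of_le fun x y s t hs ht hst => ?_
    obtain ⟨m, k, hm, hX, h⟩ := touch (s * x + t * y)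
    have hx := mul_le_mul_of_nonneg_left (below m k hm hX x) hs
    have hy := mul_le_mul_of_nonneg_left (below m k hm hX y) ht
    have : m * (s * x + t * y) + k = s * (m * x + k) + t * (m * y + k) := by
      linear_combination (-k) * hst
    linarith

/-! ### Separately convex functions -/

/-- A function of two real variables that is convex in each of them. -/
structure SepConvex (ψ : ℝ → ℝ → ℝ) : Prop where
  left : ∀ y, ConvexOn ℝ Set.univ (fun x => ψ x y)
  right : ∀ x, ConvexOn ℝ Set.univ (ψ x)

theorem SepConvex.swap {ψ : ℝ → ℝ → ℝ} (h : SepConvex ψ) : SepConvex (fun x y => ψ y x) :=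
  ⟨h.right, h.left⟩

theorem SepConvex.add {ψ χ : ℝ → ℝ → ℝ} (h : SepConvex ψ) (h' : SepConvex χ) :
    SepConvex (fun x y => ψ x y + χ x y) :=
  ⟨fun y => (h.left y).add (h'.left y), fun x => (h.right x).add (h'.right x)⟩

theorem SepConvex.sup {ψ χ : ℝ → ℝ → ℝ} (h : SepConvex ψ) (h' : SepConvex χ) :
    SepConvex (fun x y => max (ψ x y) (χ x y)) :=
  ⟨fun y => (h.left y).sup (h'.left y), fun x => (h.right x).sup (h'.right x)⟩

theorem SepConvex.const_mul {ψ : ℝ → ℝ → ℝ} (h : SepConvex ψ) {c : ℝ} (hc : 0 ≤ c) :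
    SepConvex (fun x y => c * ψ x y) :=
  ⟨fun y => (h.left y).smul hc, fun x => (h.right x).smul hc⟩

theorem SepConvex.of_left {φ : ℝ → ℝ} (h : ConvexOn ℝ Set.univ φ) : SepConvex (fun x _ => φ x) :=
  ⟨fun _ => h, fun x => convexOn_const (φ x) convex_univ⟩

theorem sepConvex_const (c : ℝ) : SepConvex (fun _ _ => c) :=
  .of_left (convexOn_const c convex_univ)

/-- Replacing a separately convex function by its chords in the first variable over a strip
`(a, b) × ℝ` preserves separate convexity: along the first variable the new function is the maximum
of the old one and of an affine function. -/
theorem SepConvex.exists_interp_left {ψ : ℝ → ℝ → ℝ} (hψ : SepConvex ψ) {a b : ℝ} (hab : a ≤ b) :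
    ∃ G, SepConvex G ∧ (∀ x, x ∉ Set.Ioo a b → ∀ y, G x y = ψ x y) ∧
      ∀ x ∈ Set.Icc a b, ∀ y, G x y = interp a b (fun r => ψ r y) x := by
  rcases eq_or_lt_of_le hab with rfl | hlt
  · refine ⟨ψ, hψ, fun _ _ _ => rfl, fun x hx y => ?_⟩
    obtain rfl : x = a := le_antisymm hx.2 hx.1
    rw [interp_left]
  have hout : ∀ x, x ∉ Set.Ioo a b → ∀ y,
      max (ψ x y) (interp a b (fun r => ψ r y) x) = ψ x y := by
    intro x hx y
    refine max_eq_left (interp_le (hψ.left y) hlt ?_)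
    by_contra! h
    exact hx h
  have hin : ∀ x ∈ Set.Icc a b, ∀ y,
      max (ψ x y) (interp a b (fun r => ψ r y) x) = interp a b (fun r => ψ r y) x :=
    fun x hx y => max_eq_right (le_interp (hψ.left y) hx)
  refine ⟨fun x y => max (ψ x y) (interp a b (fun r => ψ r y) x), ⟨fun y => ?_, fun x => ?_⟩,
    hout, hin⟩
  · exact (hψ.left y).sup (convexOn_interp a b _)
  · by_cases hx : x ∈ Set.Icc a b
    · simp only [hin x hx]
      obtain ⟨t, ht, -, h⟩ := interp_eq_combo hx
      simp only [h]
      exact ((hψ.right a).smul (sub_nonneg.2 ht.2)).add ((hψ.right b).smul ht.1)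
    · simp only [hout x fun h => hx ⟨h.1.le, h.2.le⟩]
      exact hψ.right x

/-- The bilinear function that agrees with `ψ` at the vertices of `[a, b] × [c, d]`. -/
noncomputable def bilinInterp (a b c d : ℝ) (ψ : ℝ → ℝ → ℝ) (x y : ℝ) : ℝ :=
  interp a b (fun r => interp c d (ψ r) y) x

theorem SepConvex.exists_bilinInterp {ψ : ℝ → ℝ → ℝ} (hψ : SepConvex ψ) {a b c d : ℝ}
    (hab : a ≤ b) (hcd : c ≤ d) :
    ∃ G, SepConvex G ∧ (∀ x, x ∉ Set.Ioo a b → ∀ y, y ∉ Set.Ioo c d → G x y = ψ x y) ∧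
      ∀ x ∈ Set.Icc a b, ∀ y ∈ Set.Icc c d, G x y = bilinInterp a b c d ψ x y := by
  obtain ⟨G₁, h₁, hout₁, hin₁⟩ := hψ.swap.exists_interp_left hcd
  obtain ⟨G, h, hout, hin⟩ := h₁.swap.exists_interp_left hab
  refine ⟨G, h, fun x hx y hy => ?_, fun x hx y hy => ?_⟩
  · rw [hout x hx, hout₁ y hy]
  · rw [hin x hx]
    simp only [hin₁ y hy, bilinInterp]

theorem SepConvex.le_bilinInterp {ψ : ℝ → ℝ → ℝ} (hψ : SepConvex ψ) {a b c d x y : ℝ}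
    (hx : x ∈ Set.Icc a b) (hy : y ∈ Set.Icc c d) : ψ x y ≤ bilinInterp a b c d ψ x y :=
  (le_interp (hψ.left y) hx).trans
    (interp_mono hx (le_interp (hψ.right a) hy) (le_interp (hψ.right b) hy))

theorem bilinInterp_mono {ψ χ : ℝ → ℝ → ℝ} {a b c d x y : ℝ}
    (hx : x ∈ Set.Icc a b) (hy : y ∈ Set.Icc c d)
    (h : ∀ r, (r = a ∨ r = b) → ∀ s, (s = c ∨ s = d) → ψ r s ≤ χ r s) :
    bilinInterp a b c d ψ x y ≤ bilinInterp a b c d χ x y :=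
  interp_mono hx (interp_mono hy (h a (.inl rfl) c (.inl rfl)) (h a (.inl rfl) d (.inr rfl)))
    (interp_mono hy (h b (.inr rfl) c (.inl rfl)) (h b (.inr rfl) d (.inr rfl)))

theorem bilinInterp_add_const (a b c d : ℝ) (ψ : ℝ → ℝ → ℝ) (k x y : ℝ) :
    bilinInterp a b c d (fun r s => ψ r s + k) x y = bilinInterp a b c d ψ x y + k := by
  simp only [bilinInterp, interp_add_const]

/-! ### Extension from a finite grid with bounded mixed differences -/

theorem exists_le_mul_of_finite {α : Type*} {T : Set α} (hT : T.Finite) (f g : α → ℝ)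
    (hg : ∀ t ∈ T, 0 ≤ g t) (hfg : ∀ t ∈ T, g t = 0 → f t ≤ 0) :
    ∃ L, 0 ≤ L ∧ ∀ t ∈ T, f t ≤ L * g t := by
  obtain ⟨B, hB⟩ := (hT.image fun t => f t / g t).bddAbove
  refine ⟨max B 0, le_max_right _ _, fun t ht => ?_⟩
  rcases (hg t ht).eq_or_lt with h | h
  · rw [← h, mul_zero]; exact hfg t ht h.symm
  · rw [← div_le_iff₀ h]
    exact (hB ⟨t, ht, rfl⟩).trans (le_max_left _ _)

/-- On a finite grid every separately convex function coincides with one whose mixed second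
differences are bounded by a multiple of the product of the increments. -/
theorem SepConvex.exists_extension {ψ : ℝ → ℝ → ℝ} (hψ : SepConvex ψ) {X Y : Set ℝ}
    (hX : X.Finite) (hY : Y.Finite) :
    ∃ (G : ℝ → ℝ → ℝ) (M : ℝ), SepConvex G ∧ 0 ≤ M ∧ (∀ x ∈ X, ∀ y ∈ Y, G x y = ψ x y) ∧
      ∀ x x' y y', |G x' y' - G x' y - G x y' + G x y| ≤ M * |x' - x| * |y' - y| := by
  -- Two further nodes make both node sets nontrivial.
  have key : ∀ X : Set ℝ, (insert 0 (insert 1 X)).Nontrivial := fun X =>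
    ⟨0, by simp, 1, by simp, zero_ne_one⟩
  have hX' := (hX.insert 1).insert 0
  have hY' := (hY.insert 1).insert 0
  obtain ⟨I, d, hI1, hI2, hI3, hI4, hI5⟩ := exists_piecewise_interpolation hX' (key X)
  obtain ⟨J, e, hJ1, hJ2, hJ3, hJ4, hJ5⟩ := exists_piecewise_interpolation hY' (key Y)
  have hXs : X ⊆ insert 0 (insert 1 X) := fun x hx => .inr (.inr hx)
  have hYs : Y ⊆ insert 0 (insert 1 Y) := fun x hx => .inr (.inr hx)
  generalize (insert 0 (insert 1 X) : Set ℝ) = X' at *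
  generalize (insert 0 (insert 1 Y) : Set ℝ) = Y' at *
  obtain ⟨L₁, hL₁, h₁⟩ := exists_le_mul_of_finite ((hX'.prod hX').prod hY')
    (fun t => |ψ t.1.1 t.2 - ψ t.1.2 t.2|) (fun t => |t.1.1 - t.1.2|) (fun _ _ => abs_nonneg _)
    (fun t _ ht => by rw [sub_eq_zero.1 (abs_eq_zero.1 ht)]; simp)
  obtain ⟨L₂, hL₂, h₂⟩ := exists_le_mul_of_finite (hX'.prod (hY'.prod hY'))
    (fun t => |ψ t.1 t.2.1 - ψ t.1 t.2.2|) (fun t => |t.2.1 - t.2.2|) (fun _ _ => abs_nonneg _)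
    (fun t _ ht => by rw [sub_eq_zero.1 (abs_eq_zero.1 ht)]; simp)
  obtain ⟨M, hM, h₃⟩ := exists_le_mul_of_finite ((hX'.prod hX').prod (hY'.prod hY'))
    (fun t => |(ψ t.1.1 t.2.1 - ψ t.1.2 t.2.1) - (ψ t.1.1 t.2.2 - ψ t.1.2 t.2.2)|)
    (fun t => |t.1.1 - t.1.2| * |t.2.1 - t.2.2|) (fun _ _ => by positivity)
    (fun t _ ht => by
      rcases mul_eq_zero.1 ht with ht | ht <;>
      · rw [sub_eq_zero.1 (abs_eq_zero.1 ht)]; simp)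
  have hJconv : ∀ y, ConvexOn ℝ Set.univ (fun p => J (ψ p) y) := by
    intro y
    obtain ⟨r, -, s, -, t, ht, h⟩ := hJ1 y
    simp only [h]
    exact ((hψ.left r).smul (sub_nonneg.2 ht.2)).add ((hψ.left s).smul ht.1)
  have hJlip : ∀ y, ∀ p ∈ X', ∀ q ∈ X', |J (ψ p) y - J (ψ q) y| ≤ L₁ * |p - q| := by
    intro y p hp q hq
    obtain ⟨r, hr, s, hs, t, ht, h⟩ := hJ1 y
    have e1 := abs_le.1 (h₁ ((p, q), r) ⟨⟨hp, hq⟩, hr⟩)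
    have e2 := abs_le.1 (h₁ ((p, q), s) ⟨⟨hp, hq⟩, hs⟩)
    have ht' := sub_nonneg.2 ht.2
    rw [h, h, abs_le]
    constructor
    · nlinarith [mul_le_mul_of_nonneg_left e1.1 ht', mul_le_mul_of_nonneg_left e2.1 ht.1]
    · nlinarith [mul_le_mul_of_nonneg_left e1.2 ht', mul_le_mul_of_nonneg_left e2.2 ht.1]
  refine ⟨fun x y => I (fun p => J (ψ p) y) x + L₁ * d x + L₂ * e y, M, ⟨fun y => ?_, fun x => ?_⟩,
    hM, fun x hx y hy => ?_, fun x x' y y' => ?_⟩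
  · exact (hI5 _ L₁ hL₁ (hJconv y) (hJlip y)).add_const _
  · obtain ⟨p, hp, q, hq, t, ht, h⟩ := hI1 x
    have hp' := hJ5 (ψ p) L₂ hL₂ (hψ.right p) fun r hr s hs => h₂ (p, (r, s)) ⟨hp, hr, hs⟩
    have hq' := hJ5 (ψ q) L₂ hL₂ (hψ.right q) fun r hr s hs => h₂ (q, (r, s)) ⟨hq, hr, hs⟩
    refine (((hp'.smul (sub_nonneg.2 ht.2)).add (hq'.smul ht.1)).add_const (L₁ * d x)).congr
      fun y _ => ?_
    simp only [h, Pi.add_apply, smul_eq_mul]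
    ring
  · simp only
    rw [hI2 _ x (hXs hx), hJ2 _ y (hYs hy), hI3 x (hXs hx), hJ3 y (hYs hy)]
    ring
  · have hlin : ∀ z, I (fun p => J (ψ p) y' - J (ψ p) y) z =
        I (fun p => J (ψ p) y') z - I (fun p => J (ψ p) y) z := by
      intro z
      obtain ⟨p, -, q, -, t, -, h⟩ := hI1 z
      simp only [h]; ring
    have hJlin : ∀ p q z, J (fun r => ψ p r - ψ q r) z = J (ψ p) z - J (ψ q) z := by
      intro p q z
      obtain ⟨r, -, s, -, t, -, h⟩ := hJ1 z
      simp only [h]; ring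
    have hχ := hI4 (fun p => J (ψ p) y' - J (ψ p) y) (M * |y' - y|) (by positivity)
      (fun p hp q hq => by
        have h := hJ4 (fun r => ψ p r - ψ q r) (M * |p - q|) (by positivity)
          (fun r hr s hs => by
            rw [mul_assoc]; exact h₃ ((p, q), (r, s)) ⟨⟨hp, hq⟩, hr, hs⟩) y' y
        rw [hJlin, hJlin] at h
        calc |J (ψ p) y' - J (ψ p) y - (J (ψ q) y' - J (ψ q) y)|
            = |J (ψ p) y' - J (ψ q) y' - (J (ψ p) y - J (ψ q) y)| := by congr 1; ring
          _ ≤ M * |p - q| * |y' - y| := h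
          _ = M * |y' - y| * |p - q| := by ring) x' x
    rw [hlin, hlin] at hχ
    calc _ = |I (fun p => J (ψ p) y') x' - I (fun p => J (ψ p) y) x' -
          (I (fun p => J (ψ p) y') x - I (fun p => J (ψ p) y) x)| := by congr 1; ring
      _ ≤ M * |y' - y| * |x' - x| := hχ
      _ = M * |x' - x| * |y' - y| := by ring

/-- Bounded mixed differences quantify the failure of joint convexity. -/
theorem SepConvex.le_of_mixed {G : ℝ → ℝ → ℝ} (hG : SepConvex G) {M : ℝ}
    (hM : ∀ x x' y y', |G x' y' - G x' y - G x y' + G x y| ≤ M * |x' - x| * |y' - y|)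
    {s t : ℝ} (hs : 0 ≤ s) (ht : 0 ≤ t) (hst : s + t = 1) (x₁ x₂ y₁ y₂ : ℝ) :
    G (s * x₁ + t * x₂) (s * y₁ + t * y₂) ≤
      s * G x₁ y₁ + t * G x₂ y₂ + s * t * (M * |x₁ - x₂| * |y₁ - y₂|) := by
  obtain rfl : s = 1 - t := by linarith
  set x := (1 - t) * x₁ + t * x₂ with hx
  set y := (1 - t) * y₁ + t * y₂ with hy
  have h1 := (abs_le.1 (hM x x₁ y y₁)).1
  have h2 := (abs_le.1 (hM x x₂ y y₂)).1
  have ex1 : |x₁ - x| = t * |x₁ - x₂| := by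
    rw [show x₁ - x = t * (x₁ - x₂) by rw [hx]; ring, abs_mul, abs_of_nonneg ht]
  have ey1 : |y₁ - y| = t * |y₁ - y₂| := by
    rw [show y₁ - y = t * (y₁ - y₂) by rw [hy]; ring, abs_mul, abs_of_nonneg ht]
  have ex2 : |x₂ - x| = (1 - t) * |x₁ - x₂| := by
    rw [show x₂ - x = -((1 - t) * (x₁ - x₂)) by rw [hx]; ring, abs_neg, abs_mul, abs_of_nonneg hs]
  have ey2 : |y₂ - y| = (1 - t) * |y₁ - y₂| := by
    rw [show y₂ - y = -((1 - t) * (y₁ - y₂)) by rw [hy]; ring, abs_neg, abs_mul, abs_of_nonneg hs]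
  rw [ex1, ey1] at h1
  rw [ex2, ey2] at h2
  have h3 : G x y ≤ (1 - t) * G x₁ y + t * G x₂ y := convexOn_univ_le (hG.left y) hs ht hst
  have h4 : G x y ≤ (1 - t) * G x y₁ + t * G x y₂ := convexOn_univ_le (hG.right x) hs ht hst
  have h5 := mul_le_mul_of_nonneg_left h1 hs
  have h6 := mul_le_mul_of_nonneg_left h2 ht
  linear_combination h3 + h4 + h5 + h6

/-! ### Rank-one matrices and rank-one convexity for `2 × 2` matrices -/

theorem rank_vecMulVec_eq_one {w v : Fin 2 → ℝ} (h : Matrix.vecMulVec w v ≠ 0) :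
    (Matrix.vecMulVec w v).rank = 1 := by
  refine le_antisymm (Matrix.rank_vecMulVec_le w v) (Nat.one_le_iff_ne_zero.2 fun h0 => h ?_)
  rw [Matrix.rank, Submodule.finrank_eq_zero, LinearMap.range_eq_bot] at h0
  exact Matrix.toLin'.injective (by simpa [Matrix.toLin'_apply'] using h0)

theorem rank_row_eq_one {p q : ℝ} (h : ¬(p = 0 ∧ q = 0)) : (!![p, q; 0, 0]).rank = 1 := by
  have e : !![p, q; 0, 0] = Matrix.vecMulVec ![1, 0] ![p, q] := by
    ext i j; fin_cases i <;> fin_cases j <;> simp [Matrix.vecMulVec_apply]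
  rw [e]
  refine rank_vecMulVec_eq_one fun h0 => h ⟨?_, ?_⟩
  · simpa [Matrix.vecMulVec_apply] using congrFun (congrFun h0 0) 0
  · simpa [Matrix.vecMulVec_apply] using congrFun (congrFun h0 0) 1

theorem rank_col_eq_one {p q : ℝ} (h : ¬(p = 0 ∧ q = 0)) : (!![0, p; 0, q]).rank = 1 := by
  have e : !![0, p; 0, q] = Matrix.vecMulVec ![p, q] ![0, 1] := by
    ext i j; fin_cases i <;> fin_cases j <;> simp [Matrix.vecMulVec_apply]
  rw [e]
  refine rank_vecMulVec_eq_one fun h0 => h ⟨?_, ?_⟩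
  · simpa [Matrix.vecMulVec_apply] using congrFun (congrFun h0 0) 1
  · simpa [Matrix.vecMulVec_apply] using congrFun (congrFun h0 1) 1

theorem mul_eq_mul_of_rank_eq_one {B : Matrix (Fin 2) (Fin 2) ℝ} (h : B.rank = 1) :
    B 0 0 * B 1 1 = B 0 1 * B 1 0 := by
  by_contra hne
  have := Matrix.rank_of_det_ne_zero (A := B) (by rw [Matrix.det_fin_two]; exact sub_ne_zero.2 hne)
  simp [h] at this

section
variable {F : Matrix (Fin 2) (Fin 2) ℝ → ℝ}

theorem IsRankOneConvex.le_combo (hF : IsRankOneConvex F) (A B : Matrix (Fin 2) (Fin 2) ℝ)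
    (hAB : (A - B).rank = 1) {s t : ℝ} (hs : 0 ≤ s) (ht : 0 ≤ t) (hst : s + t = 1) :
    F (s • A + t • B) ≤ s * F A + t * F B := by
  have h := convexOn_univ_le (hF B (A - B) hAB) (x := 1) (y := 0) hs ht hst
  have e : B + (s * 1 + t * 0) • (A - B) = s • A + t • B := by
    obtain rfl : t = 1 - s := by linarith
    module
  rw [e] at h
  simpa using h

/-- On upper triangular matrices with fixed lower diagonal entry a rank-one convex function is
jointly convex in the two remaining entries. -/
theorem IsRankOneConvex.le_row (hF : IsRankOneConvex F) (x₁ x₂ z₁ z₂ y : ℝ) {s t : ℝ}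
    (hs : 0 ≤ s) (ht : 0 ≤ t) (hst : s + t = 1) :
    F !![s * x₁ + t * x₂, s * z₁ + t * z₂; 0, y] ≤
      s * F !![x₁, z₁; 0, y] + t * F !![x₂, z₂; 0, y] := by
  have e : s • !![x₁, z₁; 0, y] + t • !![x₂, z₂; 0, y] =
      !![s * x₁ + t * x₂, s * z₁ + t * z₂; 0, y] := by
    have : s * y + t * y = y := by rw [← add_mul, hst, one_mul]
    ext i j; fin_cases i <;> fin_cases j <;> simp [this]
  by_cases h : x₁ - x₂ = 0 ∧ z₁ - z₂ = 0
  · obtain ⟨rfl, rfl⟩ : x₁ = x₂ ∧ z₁ = z₂ := ⟨sub_eq_zero.1 h.1, sub_eq_zero.1 h.2⟩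
    rw [← add_mul, ← add_mul, ← add_mul, hst, one_mul, one_mul, one_mul]
  · rw [← e]
    refine hF.le_combo _ _ ?_ hs ht hst
    convert rank_row_eq_one h using 2
    ext i j; fin_cases i <;> fin_cases j <;> simp

theorem IsRankOneConvex.le_col (hF : IsRankOneConvex F) (y₁ y₂ z₁ z₂ x : ℝ) {s t : ℝ}
    (hs : 0 ≤ s) (ht : 0 ≤ t) (hst : s + t = 1) :
    F !![x, s * z₁ + t * z₂; 0, s * y₁ + t * y₂] ≤
      s * F !![x, z₁; 0, y₁] + t * F !![x, z₂; 0, y₂] := by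
  have e : s • !![x, z₁; 0, y₁] + t • !![x, z₂; 0, y₂] =
      !![x, s * z₁ + t * z₂; 0, s * y₁ + t * y₂] := by
    have : s * x + t * x = x := by rw [← add_mul, hst, one_mul]
    ext i j; fin_cases i <;> fin_cases j <;> simp [this]
  by_cases h : z₁ - z₂ = 0 ∧ y₁ - y₂ = 0
  · obtain ⟨rfl, rfl⟩ : y₁ = y₂ ∧ z₁ = z₂ := ⟨sub_eq_zero.1 h.2, sub_eq_zero.1 h.1⟩
    rw [← add_mul, ← add_mul, ← add_mul, hst, one_mul, one_mul, one_mul]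
  · rw [← e]
    refine hF.le_combo _ _ ?_ hs ht hst
    convert rank_col_eq_one h using 2
    ext i j; fin_cases i <;> fin_cases j <;> simp

end

/-- A separately convex function of the diagonal entries with bounded mixed differences becomes
rank-one convex on all of `ℝ^{2×2}` after a suitable quadratic function of the off-diagonal entries
is added: along a rank-one direction `B` the mixed term is controlled by `|B₀₀ B₁₁| = |B₀₁ B₁₀|`. -/
theorem isRankOneConvex_of_mixed {G : ℝ → ℝ → ℝ} (hG : SepConvex G) {M : ℝ} (hM0 : 0 ≤ M)
    (hM : ∀ x x' y y', |G x' y' - G x' y - G x y' + G x y| ≤ M * |x' - x| * |y' - y|)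
    (ξ : ℝ) {ε : ℝ} (hε : 0 < ε) :
    IsRankOneConvex fun A : Matrix (Fin 2) (Fin 2) ℝ =>
      ξ * A 0 1 + G (A 0 0) (A 1 1) + ε * A 0 1 ^ 2 + M ^ 2 / ε * A 1 0 ^ 2 := by
  intro A B hB
  have hdet := mul_eq_mul_of_rank_eq_one hB
  refine convexOn_univ_of_le fun u v s t hs ht hst => ?_
  simp only [Matrix.add_apply, Matrix.smul_apply, smul_eq_mul]
  have h := hG.le_of_mixed hM hs ht hst (A 0 0 + u * B 0 0) (A 0 0 + v * B 0 0)
    (A 1 1 + u * B 1 1) (A 1 1 + v * B 1 1)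
  have e0 : s * (A 0 0 + u * B 0 0) + t * (A 0 0 + v * B 0 0) =
      A 0 0 + (s * u + t * v) * B 0 0 := by linear_combination A 0 0 * hst
  have e1 : s * (A 1 1 + u * B 1 1) + t * (A 1 1 + v * B 1 1) =
      A 1 1 + (s * u + t * v) * B 1 1 := by linear_combination A 1 1 * hst
  have e2 : M * |A 0 0 + u * B 0 0 - (A 0 0 + v * B 0 0)| *
      |A 1 1 + u * B 1 1 - (A 1 1 + v * B 1 1)| = (u - v) ^ 2 * (M * |B 0 1| * |B 1 0|) := by
    rw [show A 0 0 + u * B 0 0 - (A 0 0 + v * B 0 0) = (u - v) * B 0 0 by ring,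
      show A 1 1 + u * B 1 1 - (A 1 1 + v * B 1 1) = (u - v) * B 1 1 by ring, mul_assoc, ← abs_mul,
      mul_assoc M, ← abs_mul (B 0 1), ← hdet,
      show (u - v) * B 0 0 * ((u - v) * B 1 1) = (u - v) ^ 2 * (B 0 0 * B 1 1) by ring, abs_mul,
      abs_of_nonneg (sq_nonneg (u - v))]
    ring
  rw [e0, e1, e2] at h
  have e3 : M * |B 0 1| * |B 1 0| ≤ ε * B 0 1 ^ 2 + M ^ 2 / ε * B 1 0 ^ 2 := by
    have h1 : 0 ≤ (ε * |B 0 1| - M * |B 1 0|) ^ 2 := sq_nonneg _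
    have h2 : 0 ≤ M * |B 0 1| * |B 1 0| := by positivity
    have h3 : ε * (ε * B 0 1 ^ 2 + M ^ 2 / ε * B 1 0 ^ 2) =
        ε ^ 2 * |B 0 1| ^ 2 + M ^ 2 * |B 1 0| ^ 2 := by
      rw [sq_abs, sq_abs]; field_simp
    refine le_of_mul_le_mul_left ?_ hε
    rw [h3]
    nlinarith
  have e4 := mul_le_mul_of_nonneg_left e3 (mul_nonneg (mul_nonneg hs ht) (sq_nonneg (u - v)))
  generalize M ^ 2 / ε = k at *
  obtain rfl : s = 1 - t := by linarith
  linear_combination h + e4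

/-! ### The hull in terms of separately convex functions -/

/-- The separately convex functions `ψ` for which `σ z + ψ(x, y) ≤ 0` on the set `K`. -/
def testFunctions (K : Set (Matrix (Fin 2) (Fin 2) ℝ)) (σ : ℝ) : Set (ℝ → ℝ → ℝ) :=
  {ψ | SepConvex ψ ∧ ∀ A ∈ K, σ * A 0 1 + ψ (A 0 0) (A 1 1) ≤ 0}

/-- The points of `ℝ³` that no function `± z + ψ(x, y)` with `ψ` separately convex separates
from `K`. -/
def triHull (K : Set (Matrix (Fin 2) (Fin 2) ℝ)) : Set (Fin 3 → ℝ) :=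
  {v | ∀ σ : ℝ, σ = 1 ∨ σ = -1 → ∀ ψ ∈ testFunctions K σ, σ * v 2 + ψ (v 0) (v 1) ≤ 0}

section
variable {K : Set (Matrix (Fin 2) (Fin 2) ℝ)}

theorem exists_const_mem_testFunctions (hK : K.Finite) (σ : ℝ) :
    ∃ c : ℝ, (fun _ _ => c) ∈ testFunctions K σ := by
  obtain ⟨B, hB⟩ := (hK.image fun A => σ * A 0 1).bddAbove
  exact ⟨-B, sepConvex_const _, fun A hA => by have := hB ⟨A, hA, rfl⟩; simp only at this ⊢; linarith⟩

/-- Separately convex functions of `x` and `y` alone do not separate points of the hull either. -/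
theorem le_zero_of_mem_triHull (hK : K.Finite) {v : Fin 3 → ℝ} (hv : v ∈ triHull K)
    {χ : ℝ → ℝ → ℝ} (hχ : SepConvex χ) (hχK : ∀ A ∈ K, χ (A 0 0) (A 1 1) ≤ 0) :
    χ (v 0) (v 1) ≤ 0 := by
  obtain ⟨c, hc, hcK⟩ := exists_const_mem_testFunctions hK 1
  by_contra! hpos
  obtain ⟨n, hn⟩ := exists_nat_gt (-(v 2 + c) / χ (v 0) (v 1))
  have h := hv 1 (.inl rfl) (fun x y => c + n * χ x y)
    ⟨hc.add (hχ.const_mul (Nat.cast_nonneg n)), fun A hA => by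
      have h1 := hcK A hA
      have h2 := mul_nonpos_of_nonneg_of_nonpos (Nat.cast_nonneg (α := ℝ) n) (hχK A hA)
      simp only at h1 ⊢
      linarith⟩
  rw [div_lt_iff₀ hpos] at hn
  simp only [one_mul] at h
  linarith

/-- No function `ξ z + ψ(x, y)` separates a point of the hull from `K`, whatever `ξ` is. -/
theorem le_zero_of_mem_triHull' (hK : K.Finite) {v : Fin 3 → ℝ} (hv : v ∈ triHull K) {ξ : ℝ}
    {ψ : ℝ → ℝ → ℝ} (hψ : ψ ∈ testFunctions K ξ) : ξ * v 2 + ψ (v 0) (v 1) ≤ 0 := by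
  rcases eq_or_ne ξ 0 with rfl | hξ
  · have := le_zero_of_mem_triHull hK hv hψ.1 fun A hA => by simpa using hψ.2 A hA
    simpa using this
  · have hpos : 0 < |ξ| := abs_pos.2 hξ
    have hσ : |ξ|⁻¹ * ξ = 1 ∨ |ξ|⁻¹ * ξ = -1 := by
      rcases hξ.lt_or_gt with h | h
      · right; rw [abs_of_neg h]; field_simp
      · left; rw [abs_of_pos h]; field_simp
    have h := hv _ hσ (fun x y => |ξ|⁻¹ * ψ x y) ⟨hψ.1.const_mul (inv_nonneg.2 hpos.le),
      fun A hA => by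
        rw [mul_assoc, ← mul_add]
        exact mul_nonpos_of_nonneg_of_nonpos (inv_nonneg.2 hpos.le) (hψ.2 A hA)⟩
    rw [mul_assoc, ← mul_add] at h
    exact nonpos_of_mul_nonpos_right h (inv_pos.2 hpos)

/-- A rank-one convex function that is positive at an upper triangular matrix and nonpositive on
`K` can be replaced there by one of the form `ξ z + ψ(x, y)`: take an affine minorant of slope `ξ`
in `z` and for `ψ` the infimum of `f - ξ z` over `z`. A small multiple of `z²` makes the infimum
finite. -/
theorem exists_testFunction_of_pos {F : Matrix (Fin 2) (Fin 2) ℝ → ℝ} (hF : IsRankOneConvex F)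
    (hK : K.Finite) (hT : ∀ A ∈ K, A 1 0 = 0) (hFK : ∀ A ∈ K, F A ≤ 0) {x₀ y₀ z₀ : ℝ}
    (hpos : 0 < F !![x₀, z₀; 0, y₀]) :
    ∃ ξ, ∃ ψ ∈ testFunctions K ξ, 0 < ξ * z₀ + ψ x₀ y₀ := by
  obtain ⟨B, hB⟩ := (hK.image fun A => A 0 1 ^ 2).bddAbove
  set M := max B 0 with hMdef
  have hM : 0 ≤ M := le_max_right _ _
  set ε := F !![x₀, z₀; 0, y₀] / (M + 1) with hεdef
  have hε : 0 < ε := by positivity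
  have hεM : ε * M < F !![x₀, z₀; 0, y₀] := by
    have : ε * (M + 1) = F !![x₀, z₀; 0, y₀] := by rw [hεdef]; field_simp
    linarith
  set f : ℝ → ℝ → ℝ → ℝ := fun x y z => F !![x, z; 0, y] + ε * (z ^ 2 - M) with hf
  have hsq : ∀ z₁ z₂ s t : ℝ, 0 ≤ s → 0 ≤ t → s + t = 1 →
      ε * ((s * z₁ + t * z₂) ^ 2 - M) ≤ s * (ε * (z₁ ^ 2 - M)) + t * (ε * (z₂ ^ 2 - M)) := by
    intro z₁ z₂ s t hs ht hst
    obtain rfl : s = 1 - t := by linarith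
    have := mul_nonneg hε.le (mul_nonneg (mul_nonneg hs ht) (sq_nonneg (z₁ - z₂)))
    linear_combination this
  have hrow : ∀ x₁ x₂ z₁ z₂ y s t : ℝ, 0 ≤ s → 0 ≤ t → s + t = 1 →
      f (s * x₁ + t * x₂) y (s * z₁ + t * z₂) ≤ s * f x₁ y z₁ + t * f x₂ y z₂ := by
    intro x₁ x₂ z₁ z₂ y s t hs ht hst
    have h1 := hF.le_row x₁ x₂ z₁ z₂ y hs ht hst
    have h2 := hsq z₁ z₂ s t hs ht hst
    simp only [hf]; linarith
  have hcol : ∀ y₁ y₂ z₁ z₂ x s t : ℝ, 0 ≤ s → 0 ≤ t → s + t = 1 →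
      f x (s * y₁ + t * y₂) (s * z₁ + t * z₂) ≤ s * f x y₁ z₁ + t * f x y₂ z₂ := by
    intro y₁ y₂ z₁ z₂ x s t hs ht hst
    have h1 := hF.le_col y₁ y₂ z₁ z₂ x hs ht hst
    have h2 := hsq z₁ z₂ s t hs ht hst
    simp only [hf]; linarith
  have hFz : ∀ x y, ConvexOn ℝ Set.univ (fun z => F !![x, z; 0, y]) := fun x y =>
    convexOn_univ_of_le fun z₁ z₂ s t hs ht hst => by
      have h := hF.le_row x x z₁ z₂ y hs ht hst
      rwa [← add_mul, hst, one_mul] at h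
  have hfz : ConvexOn ℝ Set.univ (f x₀ y₀) :=
    convexOn_univ_of_le fun z₁ z₂ s t hs ht hst => by
      have h := hrow x₀ x₀ z₁ z₂ y₀ s t hs ht hst
      rwa [← add_mul, hst, one_mul] at h
  have hlsc : ∀ {φ : ℝ → ℝ}, ConvexOn ℝ Set.univ φ → LowerSemicontinuousOn φ Set.univ :=
    fun h => (h.continuousOn isOpen_univ).lowerSemicontinuousOn
  have hf0 : 0 < f x₀ y₀ z₀ := by
    have := mul_nonneg hε.le (sq_nonneg z₀)
    simp only [hf]; linarith
  obtain ⟨ξ, k, hk, hkz⟩ := hfz.exists_affine_le_of_lt_real (a := f x₀ y₀ z₀ / 2)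
    (Set.mem_univ z₀) (by linarith) isClosed_univ (hlsc hfz)
  have hbdd : ∀ x y, BddBelow (Set.range fun z => f x y z - ξ * z) := by
    intro x y
    obtain ⟨m, n, hmn⟩ := (hFz x y).exists_affine_le_real isClosed_univ (hlsc (hFz x y))
    refine ⟨n - ε * M - (m - ξ) ^ 2 / (4 * ε), ?_⟩
    rintro _ ⟨z, rfl⟩
    have h1 := hmn z (Set.mem_univ z)
    have h2 : 0 ≤ ε * (z + (m - ξ) / (2 * ε)) ^ 2 := by positivity
    have h3 : ε * (z + (m - ξ) / (2 * ε)) ^ 2 =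
        ε * z ^ 2 + (m - ξ) * z + (m - ξ) ^ 2 / (4 * ε) := by field_simp; ring
    simp only [hf]
    linarith
  set ψ : ℝ → ℝ → ℝ := fun x y => ⨅ z, f x y z - ξ * z with hψ
  have hle : ∀ x y z, ψ x y ≤ f x y z - ξ * z := fun x y z => ciInf_le (hbdd x y) z
  -- A bound for all `z₁`, `z₂` separately passes to both infima.
  have hinf : ∀ (x₁ y₁ x₂ y₂ s t C : ℝ), 0 ≤ s → 0 ≤ t →
      (∀ z₁ z₂, C ≤ s * (f x₁ y₁ z₁ - ξ * z₁) + t * (f x₂ y₂ z₂ - ξ * z₂)) →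
      C ≤ s * ψ x₁ y₁ + t * ψ x₂ y₂ := by
    intro x₁ y₁ x₂ y₂ s t C hs ht h
    simp only [hψ]
    rw [Real.mul_iInf_of_nonneg hs, Real.mul_iInf_of_nonneg ht, ← sub_le_iff_le_add]
    refine le_ciInf fun z₁ => ?_
    rw [sub_le_iff_le_add, ← sub_le_iff_le_add']
    refine le_ciInf fun z₂ => ?_
    linarith [h z₁ z₂]
  refine ⟨ξ, ψ, ⟨⟨fun y => convexOn_univ_of_le ?_, fun x => convexOn_univ_of_le ?_⟩, ?_⟩, ?_⟩
  · intro x₁ x₂ s t hs ht hst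
    refine hinf _ _ _ _ _ _ _ hs ht fun z₁ z₂ => ?_
    have h1 := hle (s * x₁ + t * x₂) y (s * z₁ + t * z₂)
    have h2 := hrow x₁ x₂ z₁ z₂ y s t hs ht hst
    linarith
  · intro y₁ y₂ s t hs ht hst
    refine hinf _ _ _ _ _ _ _ hs ht fun z₁ z₂ => ?_
    have h1 := hle x (s * y₁ + t * y₂) (s * z₁ + t * z₂)
    have h2 := hcol y₁ y₂ z₁ z₂ x s t hs ht hst
    linarith
  · intro A hA
    have h1 := hle (A 0 0) (A 1 1) (A 0 1)
    have h2 : A 0 1 ^ 2 ≤ M := (hB ⟨A, hA, rfl⟩).trans (le_max_left _ _)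
    have h3 := mul_le_mul_of_nonneg_left h2 hε.le
    have h4 : !![A 0 0, A 0 1; 0, A 1 1] = A := by
      rw [← hT A hA]; exact (Matrix.eta_fin_two A).symm
    have h5 := hFK A hA
    simp only [hf, h4] at h1
    linarith
  · have h : f x₀ y₀ z₀ / 2 - ξ * z₀ ≤ ψ x₀ y₀ := le_ciInf fun z => by
      have := hk z (Set.mem_univ z)
      linarith
    linarith

theorem isRankOneConvex_linear (i j : Fin 2) (c : ℝ) :
    IsRankOneConvex fun A : Matrix (Fin 2) (Fin 2) ℝ => c * A i j := by
  intro A B _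
  convert convexOn_affine (c * B i j) (c * A i j) using 2
  simp only [Matrix.add_apply, Matrix.smul_apply, smul_eq_mul]; ring

/-- The rank-one convex hull of a finite set of upper triangular matrices is determined by
functions `± z + ψ(x, y)` with `ψ` separately convex. -/
theorem rcHull_eq_image_triHull (hK : K.Finite) (hT : ∀ A ∈ K, A 1 0 = 0) :
    rcHull K = triMatrix '' triHull K := by
  ext A
  constructor
  · intro hA
    have h10 : A 1 0 = 0 := by
      have h1 : 1 * A 1 0 ≤ 0 :=
        hA _ (isRankOneConvex_linear 1 0 1) 0 fun B hB => by simp [hT B hB]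
      have h2 : -1 * A 1 0 ≤ 0 :=
        hA _ (isRankOneConvex_linear 1 0 (-1)) 0 fun B hB => by simp [hT B hB]
      linarith
    refine ⟨![A 0 0, A 1 1, A 0 1], fun σ _ ψ hψ => ?_, ?_⟩
    · change σ * A 0 1 + ψ (A 0 0) (A 1 1) ≤ 0
      obtain ⟨G, M, hG, hM0, hGψ, hM⟩ := hψ.1.exists_extension
        ((hK.image fun B => B 0 0).insert (A 0 0)) ((hK.image fun B => B 1 1).insert (A 1 1))
      obtain ⟨B, hB⟩ := (hK.image fun A => A 0 1 ^ 2).bddAbove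
      rw [← hGψ _ (.inl rfl) _ (.inl rfl)]
      have hsmall : ∀ ε > 0, σ * A 0 1 + G (A 0 0) (A 1 1) ≤ ε * (B - A 0 1 ^ 2) := by
        intro ε hε
        have h := hA _ (isRankOneConvex_of_mixed hG hM0 hM σ hε) (ε * B) fun A' hA' => by
          have h1 := hψ.2 A' hA'
          rw [← hGψ _ (.inr ⟨A', hA', rfl⟩) _ (.inr ⟨A', hA', rfl⟩)] at h1
          have h2 := mul_le_mul_of_nonneg_left (hB ⟨A', hA', rfl⟩) hε.le
          simp only at h2 ⊢
          rw [hT A' hA']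
          linarith
        simp only [h10] at h
        linarith
      by_contra! hpos
      set p := σ * A 0 1 + G (A 0 0) (A 1 1) with hp
      have h1 := hsmall (p / (2 * (|B - A 0 1 ^ 2| + 1))) (by positivity)
      have h2 : p / (2 * (|B - A 0 1 ^ 2| + 1)) * (B - A 0 1 ^ 2) ≤
          p / (2 * (|B - A 0 1 ^ 2| + 1)) * (|B - A 0 1 ^ 2| + 1) := by
        gcongr
        linarith [le_abs_self (B - A 0 1 ^ 2)]
      have h3 : p / (2 * (|B - A 0 1 ^ 2| + 1)) * (|B - A 0 1 ^ 2| + 1) = p / 2 := by field_simp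
      linarith
    · simp only [triMatrix, Matrix.cons_val]
      rw [← h10]; exact (Matrix.eta_fin_two A).symm
  · rintro ⟨v, hv, rfl⟩ f hf c hc
    by_contra! hlt
    have hg : IsRankOneConvex fun A => f A - c := fun A B hB =>
      convexOn_univ_of_le fun x y s t hs ht hst => by
        have h := convexOn_univ_le (hf A B hB) (x := x) (y := y) hs ht hst
        linear_combination h + c * hst
    obtain ⟨ξ, ψ, hψ, h⟩ := exists_testFunction_of_pos hg hK hT
      (fun A hA => sub_nonpos.2 (hc A hA)) (x₀ := v 0) (y₀ := v 1) (z₀ := v 2)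
      (sub_pos.2 hlt)
    exact absurd (le_zero_of_mem_triHull' hK hv hψ) (not_le.2 h)

end

/-! ### Heights of the hull over the faces of the grid -/

section
variable {K : Set (Matrix (Fin 2) (Fin 2) ℝ)}

theorem triMatrix_injective : Function.Injective triMatrix := by
  intro v w h
  have h0 := congrFun (congrFun h 0) 0
  have h1 := congrFun (congrFun h 1) 1
  have h2 := congrFun (congrFun h 0) 1
  simp only [triMatrix, Matrix.of_apply, Matrix.cons_val] at h0 h1 h2
  ext i; fin_cases i
  exacts [h0, h1, h2]

theorem triMatrix_mem_rcHull_iff (hK : K.Finite) (hT : ∀ A ∈ K, A 1 0 = 0) (v : Fin 3 → ℝ) :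
    triMatrix v ∈ rcHull K ↔ v ∈ triHull K := by
  rw [rcHull_eq_image_triHull hK hT, triMatrix_injective.mem_set_image]

theorem mem_triHull_iff {x y z : ℝ} : ![x, y, z] ∈ triHull K ↔
    ∀ σ : ℝ, σ = 1 ∨ σ = -1 → ∀ ψ ∈ testFunctions K σ, σ * z + ψ x y ≤ 0 := Iff.rfl

theorem testFunctions_sup {σ : ℝ} {ψ χ : ℝ → ℝ → ℝ} (hψ : ψ ∈ testFunctions K σ)
    (hχ : χ ∈ testFunctions K σ) : (fun x y => max (ψ x y) (χ x y)) ∈ testFunctions K σ := by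
  refine ⟨hψ.1.sup hχ.1, fun A hA => ?_⟩
  rcases max_choice (ψ (A 0 0) (A 1 1)) (χ (A 0 0) (A 1 1)) with h | h <;> simp only [h]
  exacts [hψ.2 A hA, hχ.2 A hA]

/-- The hull contains a point above `(x, y)`. -/
def IsCovered (K : Set (Matrix (Fin 2) (Fin 2) ℝ)) (x y : ℝ) : Prop := ∃ z, ![x, y, z] ∈ triHull K

/-- The supremum of the values of the test functions at `(x, y)`. If the hull has a point above
`(x, y)`, then its heights there form the interval from the envelope for `σ = -1` to minus the
envelope for `σ = 1`. Over other points the supremum may be infinite and the value is junk. -/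
noncomputable def envelope (K : Set (Matrix (Fin 2) (Fin 2) ℝ)) (σ x y : ℝ) : ℝ :=
  sSup ((fun ψ : ℝ → ℝ → ℝ => ψ x y) '' testFunctions K σ)

theorem le_envelope {x y σ : ℝ} (h : IsCovered K x y) (hσ : σ = 1 ∨ σ = -1) {ψ : ℝ → ℝ → ℝ}
    (hψ : ψ ∈ testFunctions K σ) : ψ x y ≤ envelope K σ x y := by
  obtain ⟨z, hz⟩ := h
  refine le_csSup ⟨-(σ * z), ?_⟩ ⟨ψ, hψ, rfl⟩
  rintro _ ⟨χ, hχ, rfl⟩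
  have := mem_triHull_iff.1 hz σ hσ χ hχ
  simp only
  linarith

theorem exists_lt_testFunction (hK : K.Finite) (σ x y : ℝ) {c : ℝ} (hc : c < envelope K σ x y) :
    ∃ ψ ∈ testFunctions K σ, c < ψ x y := by
  obtain ⟨k, hk⟩ := exists_const_mem_testFunctions hK σ
  obtain ⟨_, ⟨ψ, hψ, rfl⟩, h⟩ := exists_lt_of_lt_csSup (Set.Nonempty.image _ ⟨_, hk⟩) hc
  exact ⟨ψ, hψ, h⟩

theorem mem_triHull_iff_envelope (hK : K.Finite) {x y z : ℝ} (h : IsCovered K x y) :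
    ![x, y, z] ∈ triHull K ↔ ∀ σ : ℝ, σ = 1 ∨ σ = -1 → σ * z + envelope K σ x y ≤ 0 := by
  rw [mem_triHull_iff]
  refine ⟨fun hz σ hσ => ?_, fun hz σ hσ ψ hψ => ?_⟩
  · by_contra! hlt
    obtain ⟨ψ, hψ, h'⟩ := exists_lt_testFunction hK σ x y (c := -(σ * z)) (by linarith)
    linarith [hz σ hσ ψ hψ]
  · linarith [hz σ hσ, le_envelope h hσ hψ]

theorem isGreatest_envelope (hK : K.Finite) (hT : ∀ A ∈ K, A 1 0 = 0) {x y : ℝ}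
    (h : IsCovered K x y) :
    IsGreatest {z : ℝ | triMatrix ![x, y, z] ∈ rcHull K} (-envelope K 1 x y) := by
  obtain ⟨z₀, hz₀⟩ := id h
  simp only [triMatrix_mem_rcHull_iff hK hT]
  have h1 := (mem_triHull_iff_envelope hK h).1 hz₀
  refine ⟨(mem_triHull_iff_envelope hK h).2 ?_, fun z hz => ?_⟩
  · rintro σ (rfl | rfl)
    · linarith
    · linarith [h1 1 (.inl rfl), h1 (-1) (.inr rfl)]
  · linarith [(mem_triHull_iff_envelope hK h).1 hz 1 (.inl rfl)]

theorem isLeast_envelope (hK : K.Finite) (hT : ∀ A ∈ K, A 1 0 = 0) {x y : ℝ}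
    (h : IsCovered K x y) :
    IsLeast {z : ℝ | triMatrix ![x, y, z] ∈ rcHull K} (envelope K (-1) x y) := by
  obtain ⟨z₀, hz₀⟩ := id h
  simp only [triMatrix_mem_rcHull_iff hK hT]
  have h1 := (mem_triHull_iff_envelope hK h).1 hz₀
  refine ⟨(mem_triHull_iff_envelope hK h).2 ?_, fun z hz => ?_⟩
  · rintro σ (rfl | rfl)
    · linarith [h1 1 (.inl rfl), h1 (-1) (.inr rfl)]
    · linarith
  · linarith [(mem_triHull_iff_envelope hK h).1 hz (-1) (.inr rfl)]

/-- Two test functions for opposite signs with positive sum witness that a fibre of the hull is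
empty. -/
theorem exists_testFunctions_of_not_isCovered (hK : K.Finite) {x y : ℝ} (h : ¬ IsCovered K x y) :
    ∃ ψ ∈ testFunctions K 1, ∃ χ ∈ testFunctions K (-1), 0 < ψ x y + χ x y := by
  by_contra! hle
  obtain ⟨k, hk⟩ := exists_const_mem_testFunctions hK 1
  obtain ⟨k', hk'⟩ := exists_const_mem_testFunctions hK (-1)
  refine h ⟨sSup ((fun ψ : ℝ → ℝ → ℝ => ψ x y) '' testFunctions K (-1)), mem_triHull_iff.2 ?_⟩
  rintro σ (rfl | rfl) ψ hψ
  · have : sSup ((fun ψ : ℝ → ℝ → ℝ => ψ x y) '' testFunctions K (-1)) ≤ -ψ x y := by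
      refine csSup_le ⟨_, _, hk', rfl⟩ ?_
      rintro _ ⟨χ, hχ, rfl⟩
      simp only
      linarith [hle ψ hψ χ hχ]
    linarith
  · have : ψ x y ≤ sSup ((fun ψ : ℝ → ℝ → ℝ => ψ x y) '' testFunctions K (-1)) := by
      refine le_csSup ⟨-k, ?_⟩ ⟨ψ, hψ, rfl⟩
      rintro _ ⟨χ, hχ, rfl⟩
      simp only
      linarith [hle _ hk χ hχ]
    linarith

/-- A face of the planar grid of `K`: a vertex, an edge or a cell, written as a product of two
possibly degenerate intervals between consecutive coordinates. -/
structure IsFace (K : Set (Matrix (Fin 2) (Fin 2) ℝ)) (a b c d : ℝ) : Prop where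
  fst : IsGap ((fun A => A 0 0) '' K) a b
  snd : IsGap ((fun A => A 1 1) '' K) c d

/-- Every vertex of the face has a point of the hull above it. -/
def IsVertexCovered (K : Set (Matrix (Fin 2) (Fin 2) ℝ)) (a b c d : ℝ) : Prop :=
  ∀ r, (r = a ∨ r = b) → ∀ s, (s = c ∨ s = d) → IsCovered K r s

theorem IsGap.not_mem_Ioo {s : Set ℝ} {a b c : ℝ} (h : IsGap s a b) (hc : c ∈ s) :
    c ∉ Set.Ioo a b := fun hI => by
  rcases h.2.2.2 c hc with h' | h' <;> linarith [hI.1, hI.2]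

/-- Bilinear interpolation on a face does not change a function on the grid points, where `K` is. -/
theorem IsFace.exists_bilinInterp {a b c d : ℝ} (hF : IsFace K a b c d) {ψ : ℝ → ℝ → ℝ}
    (hψ : SepConvex ψ) : ∃ G, SepConvex G ∧ (∀ A ∈ K, G (A 0 0) (A 1 1) = ψ (A 0 0) (A 1 1)) ∧
      ∀ x ∈ Set.Icc a b, ∀ y ∈ Set.Icc c d, G x y = bilinInterp a b c d ψ x y := by
  obtain ⟨G, hG, hout, hin⟩ := hψ.exists_bilinInterp hF.fst.2.2.1 hF.snd.2.2.1
  exact ⟨G, hG, fun A hA => hout _ (hF.fst.not_mem_Ioo ⟨A, hA, rfl⟩) _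
    (hF.snd.not_mem_Ioo ⟨A, hA, rfl⟩), hin⟩

/-- Over a face with covered vertices, the hull is the region between the bilinear interpolants of
its lowest and of its highest points over the vertices. -/
theorem IsFace.mem_triHull_iff {a b c d x y z : ℝ} (hK : K.Finite) (hF : IsFace K a b c d)
    (hV : IsVertexCovered K a b c d) (hx : x ∈ Set.Icc a b) (hy : y ∈ Set.Icc c d) :
    ![x, y, z] ∈ triHull K ↔
      ∀ σ : ℝ, σ = 1 ∨ σ = -1 → σ * z + bilinInterp a b c d (envelope K σ) x y ≤ 0 := by
  rw [RankOneHull.mem_triHull_iff]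
  refine ⟨fun hz σ hσ => ?_, fun hz σ hσ ψ hψ => ?_⟩
  · by_contra! hlt
    set δ := (σ * z + bilinInterp a b c d (envelope K σ) x y) / 2 with hδ
    have hδ0 : 0 < δ := by linarith
    have hex := fun r s => exists_lt_testFunction hK σ r s (c := envelope K σ r s - δ)
      (by linarith)
    choose ψ hψ hψlt using hex
    -- One test function that is nearly optimal at all four vertices.
    obtain ⟨χ, hχ, hχlt⟩ : ∃ χ ∈ testFunctions K σ, ∀ r, (r = a ∨ r = b) →
        ∀ s, (s = c ∨ s = d) → envelope K σ r s - δ ≤ χ r s := by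
      refine ⟨_, testFunctions_sup (testFunctions_sup (hψ a c) (hψ a d))
        (testFunctions_sup (hψ b c) (hψ b d)), ?_⟩
      rintro r (rfl | rfl) s (rfl | rfl)
      · exact (hψlt r s).le.trans ((le_max_left _ _).trans (le_max_left _ _))
      · exact (hψlt r s).le.trans ((le_max_right _ _).trans (le_max_left _ _))
      · exact (hψlt r s).le.trans ((le_max_left _ _).trans (le_max_right _ _))
      · exact (hψlt r s).le.trans ((le_max_right _ _).trans (le_max_right _ _))
    obtain ⟨G, hG, hGK, hin⟩ := hF.exists_bilinInterp hχ.1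
    have h1 := hz σ hσ G ⟨hG, fun A hA => by rw [hGK A hA]; exact hχ.2 A hA⟩
    rw [hin x hx y hy] at h1
    have h2 := bilinInterp_mono (ψ := fun r s => envelope K σ r s + -δ) hx hy
      (by simpa only [sub_eq_add_neg] using hχlt)
    rw [bilinInterp_add_const] at h2
    linarith
  · have h1 := hψ.1.le_bilinInterp hx hy
    have h2 := bilinInterp_mono hx hy fun r hr s hs => le_envelope (hV r hr s hs) hσ hψ
    linarith [hz σ hσ]

theorem eq_zero_of_interp_nonpos {a b x : ℝ} {φ : ℝ → ℝ} (hx : a = b ∨ x ∈ Set.Ioo a b)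
    (hxI : x ∈ Set.Icc a b) (ha : 0 ≤ φ a) (hb : 0 ≤ φ b) (h : interp a b φ x ≤ 0) :
    φ a = 0 ∧ φ b = 0 := by
  rcases hx with rfl | hx
  · obtain rfl : x = a := le_antisymm hxI.2 hxI.1
    rw [interp_left] at h
    exact ⟨le_antisymm h ha, le_antisymm h ha⟩
  · obtain ⟨t, ht, hxt, e⟩ := interp_eq_combo hxI
    rw [e] at h
    have hab : a < b := hx.1.trans hx.2
    have ht0 : 0 < t := by
      refine lt_of_le_of_ne ht.1 fun h0 => ?_
      rw [← h0] at hxt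
      linarith [hx.1]
    have ht1 : 0 < 1 - t := by
      refine lt_of_le_of_ne (sub_nonneg.2 ht.2) fun h0 => ?_
      have : t = 1 := by linarith
      rw [this] at hxt
      linarith [hx.2]
    have h1 := mul_nonneg ht1.le ha
    have h2 := mul_nonneg ht0.le hb
    exact ⟨(mul_eq_zero.1 (by linarith : (1 - t) * φ a = 0)).resolve_left ht1.ne',
      (mul_eq_zero.1 (by linarith : t * φ b = 0)).resolve_left ht0.ne'⟩

/-- If the hull has a point over the relative interior of a face, then it has points over all
vertices of the face: a separately convex function that is positive at an uncovered vertex and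
vanishes on `K` would be positive there after bilinear interpolation. -/
theorem IsFace.isVertexCovered {a b c d : ℝ} (hK : K.Finite) (hF : IsFace K a b c d)
    {v : Fin 3 → ℝ} (hv : v ∈ triHull K) (hx : v 0 ∈ Set.Icc a b) (hy : v 1 ∈ Set.Icc c d)
    (hx' : a = b ∨ v 0 ∈ Set.Ioo a b) (hy' : c = d ∨ v 1 ∈ Set.Ioo c d) :
    IsVertexCovered K a b c d := by
  intro r hr s hs
  by_contra hrs
  obtain ⟨ψ, hψ, χ, hχ, hpos⟩ := exists_testFunctions_of_not_isCovered hK hrs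
  set ω : ℝ → ℝ → ℝ := fun x y => max (ψ x y + χ x y) 0 with hω
  have hω0 : ∀ x y, 0 ≤ ω x y := fun x y => le_max_right _ _
  obtain ⟨G, hG, hGK, hin⟩ := hF.exists_bilinInterp ((hψ.1.add hχ.1).sup (sepConvex_const 0))
  have h := le_zero_of_mem_triHull hK hv hG fun A hA => by
    rw [hGK A hA]
    refine max_le ?_ le_rfl
    linarith [hψ.2 A hA, hχ.2 A hA]
  rw [hin _ hx _ hy] at h
  have hnn : ∀ x, 0 ≤ interp c d (ω x) (v 1) := fun x => by
    obtain ⟨t, ht, -, e⟩ := interp_eq_combo hy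
    rw [e]
    exact add_nonneg (mul_nonneg (sub_nonneg.2 ht.2) (hω0 _ _)) (mul_nonneg ht.1 (hω0 _ _))
  have h1 := eq_zero_of_interp_nonpos (φ := fun r => interp c d (ω r) (v 1)) hx' hx
    (hnn a) (hnn b) h
  have h2 := eq_zero_of_interp_nonpos hy' hy (hω0 a c) (hω0 a d) h1.1.le
  have h3 := eq_zero_of_interp_nonpos hy' hy (hω0 b c) (hω0 b d) h1.2.le
  have h4 : 0 < ω r s := lt_max_of_lt_left hpos
  rcases hr with rfl | rfl <;> rcases hs with rfl | rfl
  · exact h4.ne' h2.1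
  · exact h4.ne' h2.2
  · exact h4.ne' h3.1
  · exact h4.ne' h3.2

theorem exists_le_le_of_mem_triHull (hK : K.Finite) {v : Fin 3 → ℝ} (hv : v ∈ triHull K)
    (i : Fin 2) (w : ℝ) (hw : w = ![v 0, v 1] i) :
    ∃ l ∈ (fun A : Matrix (Fin 2) (Fin 2) ℝ => A i i) '' K,
      ∃ u ∈ (fun A : Matrix (Fin 2) (Fin 2) ℝ => A i i) '' K, l ≤ w ∧ w ≤ u := by
  have hne : K.Nonempty := by
    by_contra h
    have h1 := le_zero_of_mem_triHull hK hv (sepConvex_const 1) fun A hA => (h ⟨A, hA⟩).elim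
    norm_num at h1
  -- Affine functions of one coordinate bound the projection of the hull.
  have haff : ∀ m k : ℝ, (∀ A ∈ K, m * A i i + k ≤ 0) → m * w + k ≤ 0 := by
    intro m k h
    subst hw
    fin_cases i
    · exact le_zero_of_mem_triHull hK hv (.of_left (convexOn_affine m k)) h
    · exact le_zero_of_mem_triHull hK hv (SepConvex.of_left (convexOn_affine m k)).swap h
  obtain ⟨A, hA, hmin⟩ := Set.exists_min_image K (fun A => A i i) hK hne
  obtain ⟨B, hB, hmax⟩ := Set.exists_max_image K (fun A => A i i) hK hne
  refine ⟨_, ⟨A, hA, rfl⟩, _, ⟨B, hB, rfl⟩, ?_, ?_⟩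
  · have := haff (-1) (A i i) fun C hC => by linarith [hmin C hC]
    simp only; linarith
  · have := haff 1 (-(B i i)) fun C hC => by linarith [hmax C hC]
    simp only; linarith

/-- Every point of the hull lies over a face all of whose vertices are covered. -/
theorem exists_isFace (hK : K.Finite) {v : Fin 3 → ℝ} (hv : v ∈ triHull K) :
    ∃ a b c d, IsFace K a b c d ∧ IsVertexCovered K a b c d ∧ v 0 ∈ Set.Icc a b ∧
      v 1 ∈ Set.Icc c d := by
  obtain ⟨l, hl, u, hu, hlx, hxu⟩ := exists_le_le_of_mem_triHull hK hv 0 (v 0) rfl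
  obtain ⟨a, b, hab, hx, hx'⟩ := exists_isGap (hK.image _) hl hu hlx hxu
  obtain ⟨l', hl', u', hu', hly, hyu⟩ := exists_le_le_of_mem_triHull hK hv 1 (v 1) rfl
  obtain ⟨c, d, hcd, hy, hy'⟩ := exists_isGap (hK.image _) hl' hu' hly hyu
  have hF : IsFace K a b c d := ⟨hab, hcd⟩
  exact ⟨a, b, c, d, hF, hF.isVertexCovered hK hv hx hy hx' hy', hx, hy⟩

end

/-! ### The polynomials -/

open MvPolynomial in
theorem eval_quadric (α β γ δ : ℝ) (v : Fin 3 → ℝ) :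
    eval v (quadric α β γ δ) = v 2 + α * v 0 * v 1 + β * v 0 + γ * v 1 + δ := by
  simp [quadric]

open MvPolynomial in
/-- A polynomial in which some variable has coefficient `1`, and which is a combination of the
variables and a constant, has total degree one. -/
theorem totalDegree_eq_one {p : MvPolynomial (Fin 3) ℝ} {i : Fin 3} (β : Fin 3 → ℝ) (δ : ℝ)
    (hp : p = ∑ j, C (β j) * X j + C δ) (hi : β i = 1) : p.totalDegree = 1 := by
  refine le_antisymm ?_ ?_
  · rw [hp]
    refine (totalDegree_add _ _).trans (max_le ?_ (by simp))
    refine totalDegree_finsetSum_le fun j _ => (totalDegree_mul _ _).trans ?_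
    simp
  · have hc : coeff (Finsupp.single i 1) p = 1 := by
      rw [hp, coeff_add, coeff_sum]
      have h1 : ∀ j, coeff (Finsupp.single i 1) (C (β j) * X j) = if j = i then β j else 0 := by
        intro j
        rw [coeff_C_mul, coeff_X]
        by_cases h : j = i
        · simp [h]
        · rw [if_neg, if_neg h, mul_zero]
          intro h'
          exact h ((Finsupp.single_left_injective one_ne_zero) h')
      have h2 : coeff (Finsupp.single i 1) (C δ : MvPolynomial (Fin 3) ℝ) = 0 := by
        rw [coeff_C, if_neg]
        intro h
        simpa using DFunLike.congr_fun h i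
      simp [h1, h2, hi]
    have := le_totalDegree (p := p) (s := Finsupp.single i 1)
      (by rw [mem_support_iff, hc]; exact one_ne_zero)
    simpa using this

open MvPolynomial in
theorem totalDegree_quadric_zero (β γ δ : ℝ) : (quadric 0 β γ δ).totalDegree = 1 := by
  refine totalDegree_eq_one (i := 2) ![β, γ, 1] δ ?_ rfl
  simp [quadric, Fin.sum_univ_three]; ring

open MvPolynomial in
theorem totalDegree_X_sub_C (i : Fin 3) (r : ℝ) :
    (X i - C r : MvPolynomial (Fin 3) ℝ).totalDegree = 1 := by
  refine totalDegree_eq_one (i := i) (Pi.single i 1) (-r) ?_ (by simp)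
  simp [Pi.single_apply, sub_eq_add_neg, apply_ite]

/-- The polynomial `z + e(x, y)`, where `e` is bilinear with the values of `ψ` at the vertices of
`[a, b] × [c, d]`. -/
noncomputable def faceQuadric (a b c d : ℝ) (ψ : ℝ → ℝ → ℝ) : MvPolynomial (Fin 3) ℝ :=
  quadric ((b - a)⁻¹ * (d - c)⁻¹ * (ψ b d - ψ b c - ψ a d + ψ a c))
    ((b - a)⁻¹ * (ψ b c - ψ a c) -
      (b - a)⁻¹ * (d - c)⁻¹ * c * (ψ b d - ψ b c - ψ a d + ψ a c))
    ((d - c)⁻¹ * (ψ a d - ψ a c) -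
      (b - a)⁻¹ * (d - c)⁻¹ * a * (ψ b d - ψ b c - ψ a d + ψ a c))
    (ψ a c - (b - a)⁻¹ * a * (ψ b c - ψ a c) - (d - c)⁻¹ * c * (ψ a d - ψ a c) +
      (b - a)⁻¹ * (d - c)⁻¹ * a * c * (ψ b d - ψ b c - ψ a d + ψ a c))

theorem eval_faceQuadric (a b c d : ℝ) (ψ : ℝ → ℝ → ℝ) (v : Fin 3 → ℝ) :
    MvPolynomial.eval v (faceQuadric a b c d ψ) = v 2 + bilinInterp a b c d ψ (v 0) (v 1) := by
  rw [faceQuadric, eval_quadric]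
  simp only [bilinInterp, interp]
  ring

theorem totalDegree_faceQuadric {a b c d : ℝ} (ψ : ℝ → ℝ → ℝ) (h : a = b ∨ c = d) :
    (faceQuadric a b c d ψ).totalDegree = 1 := by
  rcases h with rfl | rfl
  · simp only [faceQuadric, sub_self, inv_zero, zero_mul]
    exact totalDegree_quadric_zero _ _ _
  · simp only [faceQuadric, sub_self, inv_zero, zero_mul, mul_zero]
    exact totalDegree_quadric_zero _ _ _

/-! ### `T₄` configurations over cells -/

/-- Four points above the vertices of a rectangle form a `T₄` configuration with all `κ i = 1`:
consecutive ones differ by rank-one matrices. -/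
theorem isTConfig_cellPoint {a b c d : ℝ} (hab : a < b) (hcd : c < d) (h : Fin 4 → ℝ) :
    IsTConfig (fun i => triMatrix (cellPoint a b c d h i)) := by
  have h1 : b - a ≠ 0 := sub_ne_zero.2 hab.ne'
  have h2 : d - c ≠ 0 := sub_ne_zero.2 hcd.ne'
  have h3 : a - b ≠ 0 := sub_ne_zero.2 hab.ne
  have h4 : c - d ≠ 0 := sub_ne_zero.2 hcd.ne
  refine ⟨!![a, h 3; 0, d], ![!![0, h 0 - h 3; 0, c - d], !![b - a, h 1 - h 0; 0, 0],
    !![0, h 2 - h 1; 0, d - c], !![a - b, h 3 - h 2; 0, 0]], fun _ => 1, fun i => ?_,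
    fun _ => le_rfl, ?_, fun i => ?_⟩
  · fin_cases i
    · exact rank_col_eq_one fun h => h4 h.2
    · exact rank_row_eq_one fun h => h1 h.1
    · exact rank_col_eq_one fun h => h2 h.2
    · exact rank_row_eq_one fun h => h3 h.1
  · ext i j
    fin_cases i <;> fin_cases j <;> simp [Fin.sum_univ_four]
  · have e0 : Finset.Iio (0 : Fin 4) = ∅ := by decide
    have e1 : Finset.Iio (1 : Fin 4) = {0} := by decide
    have e2 : Finset.Iio (2 : Fin 4) = {0, 1} := by decide
    have e3 : Finset.Iio (3 : Fin 4) = {0, 1, 2} := by decide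
    ext k l
    fin_cases i <;> fin_cases k <;> fin_cases l <;>
      simp [e0, e1, e2, e3, triMatrix, cellPoint]

theorem isT4Quadric_faceQuadric {a b c d : ℝ} (hab : a < b) (hcd : c < d) (ψ : ℝ → ℝ → ℝ) :
    IsT4Quadric (faceQuadric a b c d ψ)
      (cellPoint a b c d ![-ψ a c, -ψ b c, -ψ b d, -ψ a d]) := by
  refine ⟨⟨_, _, _, _, rfl⟩, isTConfig_cellPoint hab hcd _, fun i => ?_⟩
  rw [eval_faceQuadric]
  fin_cases i <;> simp [cellPoint, bilinInterp, interp_left, interp_right]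

section
variable {K : Set (Matrix (Fin 2) (Fin 2) ℝ)}

/-- The polynomial bounding the hull over a face from above. -/
noncomputable def upperQuadric (K : Set (Matrix (Fin 2) (Fin 2) ℝ)) (a b c d : ℝ) :
    MvPolynomial (Fin 3) ℝ := faceQuadric a b c d (envelope K 1)

/-- The polynomial bounding the hull over a face from below. -/
noncomputable def lowerQuadric (K : Set (Matrix (Fin 2) (Fin 2) ℝ)) (a b c d : ℝ) :
    MvPolynomial (Fin 3) ℝ := faceQuadric a b c d (fun x y => -envelope K (-1) x y)

theorem isUpperQuadric_upperQuadric (hK : K.Finite) (hT : ∀ A ∈ K, A 1 0 = 0) {a b c d : ℝ}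
    (hab : a < b) (hcd : c < d) (hV : IsVertexCovered K a b c d) :
    IsUpperQuadric K a b c d (upperQuadric K a b c d) := by
  refine ⟨_, isT4Quadric_faceQuadric hab hcd _, fun i => ?_⟩
  fin_cases i
  · exact isGreatest_envelope hK hT (hV a (.inl rfl) c (.inl rfl))
  · exact isGreatest_envelope hK hT (hV b (.inr rfl) c (.inl rfl))
  · exact isGreatest_envelope hK hT (hV b (.inr rfl) d (.inr rfl))
  · exact isGreatest_envelope hK hT (hV a (.inl rfl) d (.inr rfl))

theorem isLowerQuadric_lowerQuadric (hK : K.Finite) (hT : ∀ A ∈ K, A 1 0 = 0) {a b c d : ℝ}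
    (hab : a < b) (hcd : c < d) (hV : IsVertexCovered K a b c d) :
    IsLowerQuadric K a b c d (lowerQuadric K a b c d) := by
  refine ⟨_, isT4Quadric_faceQuadric hab hcd _, ?_⟩
  simp only [neg_neg]
  intro i
  fin_cases i
  · exact isLeast_envelope hK hT (hV a (.inl rfl) c (.inl rfl))
  · exact isLeast_envelope hK hT (hV b (.inr rfl) c (.inl rfl))
  · exact isLeast_envelope hK hT (hV b (.inr rfl) d (.inr rfl))
  · exact isLeast_envelope hK hT (hV a (.inl rfl) d (.inr rfl))

theorem IsFace.mem_triHull_iff_quadric {a b c d : ℝ} (hK : K.Finite) (hF : IsFace K a b c d)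
    (hV : IsVertexCovered K a b c d) {v : Fin 3 → ℝ} (hx : v 0 ∈ Set.Icc a b)
    (hy : v 1 ∈ Set.Icc c d) :
    v ∈ triHull K ↔ MvPolynomial.eval v (upperQuadric K a b c d) ≤ 0 ∧
      0 ≤ MvPolynomial.eval v (lowerQuadric K a b c d) := by
  have e : v = ![v 0, v 1, v 2] := by ext i; fin_cases i <;> rfl
  have hneg : bilinInterp a b c d (fun x y => -envelope K (-1) x y) (v 0) (v 1) =
      -bilinInterp a b c d (envelope K (-1)) (v 0) (v 1) := by
    simp only [bilinInterp, interp]; ring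
  rw [upperQuadric, lowerQuadric, eval_faceQuadric, eval_faceQuadric, hneg]
  nth_rewrite 1 [e]
  rw [hF.mem_triHull_iff hK hV hx hy]
  constructor
  · intro h
    constructor
    · linarith [h 1 (.inl rfl)]
    · linarith [h (-1) (.inr rfl)]
  · rintro ⟨h1, h2⟩ σ (rfl | rfl)
    · linarith
    · linarith

/-- The faces of the grid with covered vertices, as quadruples `((a, b), (c, d))`. -/
def coveredFaces (K : Set (Matrix (Fin 2) (Fin 2) ℝ)) : Set ((ℝ × ℝ) × (ℝ × ℝ)) :=
  {t | IsFace K t.1.1 t.1.2 t.2.1 t.2.2 ∧ IsVertexCovered K t.1.1 t.1.2 t.2.1 t.2.2}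

theorem finite_coveredFaces (hK : K.Finite) : (coveredFaces K).Finite := by
  refine (((hK.image fun A => A 0 0).prod (hK.image fun A => A 0 0)).prod
    ((hK.image fun A => A 1 1).prod (hK.image fun A => A 1 1))).subset ?_
  rintro ⟨⟨a, b⟩, c, d⟩ ⟨hF, -⟩
  exact ⟨⟨hF.fst.1, hF.fst.2.1⟩, hF.snd.1, hF.snd.2.1⟩

theorem triHull_eq_biUnion (hK : K.Finite) : triHull K = ⋃ t ∈ coveredFaces K,
    {v | v 0 ∈ Set.Icc t.1.1 t.1.2 ∧ v 1 ∈ Set.Icc t.2.1 t.2.2 ∧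
      MvPolynomial.eval v (upperQuadric K t.1.1 t.1.2 t.2.1 t.2.2) ≤ 0 ∧
      0 ≤ MvPolynomial.eval v (lowerQuadric K t.1.1 t.1.2 t.2.1 t.2.2)} := by
  ext v
  simp only [Set.mem_iUnion, Set.mem_ofPred_eq, exists_prop]
  constructor
  · intro hv
    obtain ⟨a, b, c, d, hF, hV, hx, hy⟩ := exists_isFace hK hv
    exact ⟨((a, b), (c, d)), ⟨hF, hV⟩, hx, hy, (hF.mem_triHull_iff_quadric hK hV hx hy).1 hv⟩
  · rintro ⟨t, ⟨hF, hV⟩, hx, hy, h⟩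
    exact (hF.mem_triHull_iff_quadric hK hV hx hy).2 h

open MvPolynomial in
theorem isSemialgebraicBy_triHull (hK : K.Finite) {P : Finset (MvPolynomial (Fin 3) ℝ)}
    (hx : ∀ r ∈ (fun A : Matrix (Fin 2) (Fin 2) ℝ => A 0 0) '' K, X 0 - C r ∈ P)
    (hy : ∀ r ∈ (fun A : Matrix (Fin 2) (Fin 2) ℝ => A 1 1) '' K, X 1 - C r ∈ P)
    (hu : ∀ t ∈ coveredFaces K, upperQuadric K t.1.1 t.1.2 t.2.1 t.2.2 ∈ P)
    (hl : ∀ t ∈ coveredFaces K, lowerQuadric K t.1.1 t.1.2 t.2.1 t.2.2 ∈ P) :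
    IsSemialgebraicBy P (triHull K) := by
  rw [triHull_eq_biUnion hK]
  refine BooleanSubalgebra.biSup_mem (finite_coveredFaces hK) fun t ht => ?_
  have hge : ∀ p ∈ P, {v : Fin 3 → ℝ | 0 ≤ eval v p} ∈ BooleanSubalgebra.closure
      {T : Set (Fin 3 → ℝ) | ∃ p ∈ P, T = {v | 0 ≤ eval v p} ∨ T = {v | eval v p ≤ 0}} :=
    fun p hp => BooleanSubalgebra.mem_closure_of_mem ⟨p, hp, .inl rfl⟩
  have hle : ∀ p ∈ P, {v : Fin 3 → ℝ | eval v p ≤ 0} ∈ BooleanSubalgebra.closure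
      {T : Set (Fin 3 → ℝ) | ∃ p ∈ P, T = {v | 0 ≤ eval v p} ∨ T = {v | eval v p ≤ 0}} :=
    fun p hp => BooleanSubalgebra.mem_closure_of_mem ⟨p, hp, .inr rfl⟩
  convert BooleanSubalgebra.inf_mem
    (BooleanSubalgebra.inf_mem (hge _ (hx _ ht.1.fst.1)) (hle _ (hx _ ht.1.fst.2.1)))
    (BooleanSubalgebra.inf_mem
      (BooleanSubalgebra.inf_mem (hge _ (hy _ ht.1.snd.1)) (hle _ (hy _ ht.1.snd.2.1)))
      (BooleanSubalgebra.inf_mem (hle _ (hu t ht)) (hge _ (hl t ht)))) using 1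
  ext v
  simp [and_assoc]

end

end RankOneHull

open RankOneHull in
theorem mainTheorem1 (K : Set (Matrix (Fin 2) (Fin 2) ℝ)) (hK : K.Finite)
    (hT : ∀ A ∈ K, A 1 0 = 0) :
    ∃ (S : Set (Fin 3 → ℝ)) (L Q : Finset (MvPolynomial (Fin 3) ℝ)),
      RankOneHull.rcHull K = RankOneHull.triMatrix '' S ∧
      RankOneHull.IsSemialgebraicBy (L ∪ Q) S ∧
      (∀ p ∈ L, p.totalDegree = 1) ∧
      (∀ q ∈ Q, ∃ a b c d : ℝ, RankOneHull.IsGridCell K a b c d ∧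
        (RankOneHull.IsUpperQuadric K a b c d q ∨ RankOneHull.IsLowerQuadric K a b c d q)) ∧
      (∀ a b c d : ℝ, RankOneHull.IsGridCell K a b c d →
        (∀ v ∈ S, ¬ (v 0 ∈ Set.Ioo a b ∧ v 1 ∈ Set.Ioo c d)) ∨
        ∃ qu ∈ Q, ∃ ql ∈ Q,
          RankOneHull.IsUpperQuadric K a b c d qu ∧ RankOneHull.IsLowerQuadric K a b c d ql ∧
          ∀ v : Fin 3 → ℝ, v 0 ∈ Set.Icc a b → v 1 ∈ Set.Icc c d →
            (v ∈ S ↔ MvPolynomial.eval v qu ≤ 0 ∧ 0 ≤ MvPolynomial.eval v ql)) := by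
  set up : (ℝ × ℝ) × (ℝ × ℝ) → MvPolynomial (Fin 3) ℝ :=
    fun t => upperQuadric K t.1.1 t.1.2 t.2.1 t.2.2 with hup
  set lo : (ℝ × ℝ) × (ℝ × ℝ) → MvPolynomial (Fin 3) ℝ :=
    fun t => lowerQuadric K t.1.1 t.1.2 t.2.1 t.2.2 with hlo
  set cells := {t ∈ coveredFaces K | t.1.1 < t.1.2 ∧ t.2.1 < t.2.2} with hcells
  set thin := {t ∈ coveredFaces K | ¬(t.1.1 < t.1.2 ∧ t.2.1 < t.2.2)} with hthin
  have hfc : cells.Finite := (finite_coveredFaces hK).subset (Set.sep_subset _ _)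
  have hft : thin.Finite := (finite_coveredFaces hK).subset (Set.sep_subset _ _)
  have hQ : (up '' cells ∪ lo '' cells).Finite := (hfc.image _).union (hfc.image _)
  have hL : ((fun A : Matrix (Fin 2) (Fin 2) ℝ =>
        (MvPolynomial.X 0 - MvPolynomial.C (A 0 0) : MvPolynomial (Fin 3) ℝ)) '' K ∪
      (fun A : Matrix (Fin 2) (Fin 2) ℝ =>
        (MvPolynomial.X 1 - MvPolynomial.C (A 1 1) : MvPolynomial (Fin 3) ℝ)) '' K ∪
      (up '' thin ∪ lo '' thin)).Finite :=
    ((hK.image _).union (hK.image _)).union ((hft.image _).union (hft.image _))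
  refine ⟨triHull K, hL.toFinset, hQ.toFinset, rcHull_eq_image_triHull hK hT, ?_, ?_, ?_, ?_⟩
  · have hmem : ∀ t ∈ coveredFaces K, up t ∈ hL.toFinset ∪ hQ.toFinset ∧
        lo t ∈ hL.toFinset ∪ hQ.toFinset := by
      intro t ht
      simp only [Finset.mem_union, Set.Finite.mem_toFinset]
      by_cases h : t.1.1 < t.1.2 ∧ t.2.1 < t.2.2
      · exact ⟨.inr (.inl ⟨t, ⟨ht, h⟩, rfl⟩), .inr (.inr ⟨t, ⟨ht, h⟩, rfl⟩)⟩
      · exact ⟨.inl (.inr (.inl ⟨t, ⟨ht, h⟩, rfl⟩)), .inl (.inr (.inr ⟨t, ⟨ht, h⟩, rfl⟩))⟩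
    refine isSemialgebraicBy_triHull hK ?_ ?_ (fun t ht => (hmem t ht).1)
      (fun t ht => (hmem t ht).2)
    · rintro _ ⟨A, hA, rfl⟩
      simp only [Finset.mem_union, Set.Finite.mem_toFinset]
      exact .inl (.inl (.inl ⟨A, hA, rfl⟩))
    · rintro _ ⟨A, hA, rfl⟩
      simp only [Finset.mem_union, Set.Finite.mem_toFinset]
      exact .inl (.inl (.inr ⟨A, hA, rfl⟩))
  · have hdeg : ∀ t ∈ thin, t.1.1 = t.1.2 ∨ t.2.1 = t.2.2 := by
      rintro t ⟨⟨hF, -⟩, h⟩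
      by_contra! hne
      exact h ⟨lt_of_le_of_ne hF.fst.2.2.1 hne.1, lt_of_le_of_ne hF.snd.2.2.1 hne.2⟩
    intro p hp
    rw [Set.Finite.mem_toFinset] at hp
    rcases hp with (⟨A, -, rfl⟩ | ⟨A, -, rfl⟩) | (⟨t, ht, rfl⟩ | ⟨t, ht, rfl⟩)
    · exact totalDegree_X_sub_C 0 _
    · exact totalDegree_X_sub_C 1 _
    · exact totalDegree_faceQuadric _ (hdeg t ht)
    · exact totalDegree_faceQuadric _ (hdeg t ht)
  · have hgrid : ∀ t ∈ cells, IsGridCell K t.1.1 t.1.2 t.2.1 t.2.2 := fun t ht =>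
      ⟨⟨ht.1.1.fst.1, ht.1.1.fst.2.1, ht.2.1, ht.1.1.fst.2.2.2⟩,
        ⟨ht.1.1.snd.1, ht.1.1.snd.2.1, ht.2.2, ht.1.1.snd.2.2.2⟩⟩
    intro q hq
    rw [Set.Finite.mem_toFinset] at hq
    rcases hq with ⟨t, ht, rfl⟩ | ⟨t, ht, rfl⟩
    · exact ⟨_, _, _, _, hgrid t ht,
        .inl (isUpperQuadric_upperQuadric hK hT ht.2.1 ht.2.2 ht.1.2)⟩
    · exact ⟨_, _, _, _, hgrid t ht,
        .inr (isLowerQuadric_lowerQuadric hK hT ht.2.1 ht.2.2 ht.1.2)⟩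
  · rintro a b c d ⟨⟨ha, hb, hab, hgap⟩, ⟨hc, hd, hcd, hgap'⟩⟩
    have hF : IsFace K a b c d := ⟨⟨ha, hb, hab.le, hgap⟩, ⟨hc, hd, hcd.le, hgap'⟩⟩
    by_cases hV : IsVertexCovered K a b c d
    · have ht : ((a, b), (c, d)) ∈ cells := ⟨⟨hF, hV⟩, hab, hcd⟩
      refine .inr ⟨upperQuadric K a b c d, ?_, lowerQuadric K a b c d, ?_,
        isUpperQuadric_upperQuadric hK hT hab hcd hV,
        isLowerQuadric_lowerQuadric hK hT hab hcd hV,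
        fun v hx hy => hF.mem_triHull_iff_quadric hK hV hx hy⟩
      · rw [Set.Finite.mem_toFinset]; exact .inl ⟨_, ht, rfl⟩
      · rw [Set.Finite.mem_toFinset]; exact .inr ⟨_, ht, rfl⟩
    · exact .inl fun v hv h => hV (hF.isVertexCovered hK hv (Set.Ioo_subset_Icc_self h.1)
        (Set.Ioo_subset_Icc_self h.2) (.inr h.1) (.inr h.2))
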